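/- \textbf{Proposition.} For a prime $p>3$ let $\phi$ be the quadratic character and $\varepsilon$ the trivial character of $\mathbb{F}_p^\times$ (all multiplicative characters, including $\varepsilon$, are complex valued and extended by $\chi(0)=0$). Put $$K(a,p)=\sum_{x\in\mathbb{F}_p^\times}e^{2\pi i(x+a\overline{x})/p},\qquad S(4,\phi)_p=\sum_{a\in\mathbb{F}_p}\phi(a)K(a,p)^4,$$ where $\overline{x}$ denotes the inverse of $x$ in $\mathbb{F}_p^\times$. For multiplicative characters $\chi,\psi$ let $J(\chi,\psi)=\sum_{y\in\mathbb{F}_p}\chi(y)\psi(1-y)$ and $\binom{\chi}{\psi}=\frac{\psi(-1)}{p}J(\chi,\overline{\psi})$, and for $x\in\mathbb{F}_p$ let $${}_2F_1(x)_p=\frac{p}{p-1}\sum_{\chi}\binom{\phi\chi}{\chi}^2\chi(x),\qquad {}_3F_2(x)_p=\frac{p}{p-1}\sum_{\chi}\binom{\phi\chi}{\chi}^3\chi(x)$$ (Greene's functions ${}_2F_1(\phi,\phi;\varepsilon\mid x)_p$ and ${}_3F_2(\phi,\phi,\phi;\varepsilon,\varepsilon\mid x)_p$), the sums being over all multiplicative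 characters $\chi$ of $\mathbb{F}_p$. Let $\omega$ be a generator of the group of multiplicative characters of $\mathbb{F}_p$ (for instance the Teichm\"uller character, regarded as complex valued via an embedding of its values into $\mathbb{C}$), let $\zeta_p\in\mathbb{C}$ be a primitive $p$-th root of unity, and let $g(\chi)=\sum_{x\in\mathbb{F}_p}\chi(x)\zeta_p^x$. Then, as $p\to\infty$ through the primes, $$\frac{S(4,\phi)_p}{p}=p^2\phi(2)\,{}_2F_1(1/2)_p^2-p^2\phi(-1)\,{}_2F_1(-1)_p^2-p^2\phi(-2)\,{}_3F_2(1)_p$$ $$\qquad+\frac{1}{p(p-1)}\sum_{\lambda\in\mathbb{F}_p}\phi(\lambda)\sum_{a=0}^{p-2}g(\phi\omega^{a})\,g(\overline{\omega}^{a})^3\,g(\phi\omega^{2a})\,\overline{\omega}^{a}\!\left(\frac{4(1-\lambda)}{\lambda}\right)+o(p^2),$$ uniformly in the choice of $\omega$ and $\zeta_p$, where the term $\lambda=0$ is read as $0$. -/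

import Mathlib

open scoped BigOperators

noncomputable section

/-- The Kloosterman sum `K(a,p) = ∑_{x ≠ 0} e^{2πi (x + a x⁻¹)/p}`. -/
def kloostermanSum (p : ℕ) [Fact p.Prime] (a : ZMod p) : ℂ :=
  ∑ x : (ZMod p)ˣ, ZMod.stdAddChar ((x : ZMod p) + a * ((x⁻¹ : (ZMod p)ˣ) : ZMod p))

/-- The `n`-th moment `S(n,χ)_p = ∑_a χ(a) K(a,p)^n` of Kloosterman sums twisted by `χ`. -/
def twistedMoment (p : ℕ) [Fact p.Prime] (n : ℕ) (χ : MulChar (ZMod p) ℂ) : ℂ :=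
  ∑ a : ZMod p, χ a * kloostermanSum p a ^ n

/-- The quadratic character `φ` of `𝔽_p`, with complex values. -/
def quadChar (p : ℕ) [Fact p.Prime] : MulChar (ZMod p) ℂ :=
  (quadraticChar (ZMod p)).ringHomComp (Int.castRingHom ℂ)

/-- The binomial coefficient (normalized Jacobi sum) `(χ choose ψ) = ψ(-1)/p · J(χ, ψ⁻¹)`. -/
def charBinom (p : ℕ) [Fact p.Prime] (χ ψ : MulChar (ZMod p) ℂ) : ℂ :=
  ψ (-1) / (p : ℂ) * jacobiSum χ ψ⁻¹

/-- Greene's Gaussian hypergeometric function `₂F₁(A, B; C | x)_p`;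
the sum runs over all multiplicative characters `χ` of `𝔽_p`. -/
def greene2F1 (p : ℕ) [Fact p.Prime] (A B C : MulChar (ZMod p) ℂ) (x : ZMod p) : ℂ :=
  (p : ℂ) / ((p : ℂ) - 1) *
    ∑ᶠ χ : MulChar (ZMod p) ℂ, charBinom p (A * χ) χ * charBinom p (B * χ) (C * χ) * χ x

/-- Greene's Gaussian hypergeometric function `₃F₂(A, B, C; D, E | x)_p`;
the sum runs over all multiplicative characters `χ` of `𝔽_p`. -/
def greene3F2 (p : ℕ) [Fact p.Prime] (A B C D E : MulChar (ZMod p) ℂ) (x : ZMod p) : ℂ :=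
  (p : ℂ) / ((p : ℂ) - 1) *
    ∑ᶠ χ : MulChar (ZMod p) ℂ,
      charBinom p (A * χ) χ * charBinom p (B * χ) (D * χ) * charBinom p (C * χ) (E * χ) * χ x

/-- `₂F₁(x)_p = ₂F₁(φ, φ; ε | x)_p`, with `φ` quadratic and `ε` trivial. -/
def hyp2F1 (p : ℕ) [Fact p.Prime] (x : ZMod p) : ℂ :=
  greene2F1 p (quadChar p) (quadChar p) 1 x

/-- `₃F₂(x)_p = ₃F₂(φ, φ, φ; ε, ε | x)_p`, with `φ` quadratic and `ε` trivial. -/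
def hyp3F2 (p : ℕ) [Fact p.Prime] (x : ZMod p) : ℂ :=
  greene3F2 p (quadChar p) (quadChar p) (quadChar p) 1 1 x

/-- The Gauss sum `g(χ) = ∑_x χ(x) ζ^x` for a `p`-th root of unity `ζ`. -/
def gSum (p : ℕ) [Fact p.Prime] (ζ : ℂ) (χ : MulChar (ZMod p) ℂ) : ℂ :=
  ∑ x : ZMod p, χ x * ζ ^ x.val

/-- The character sum
`∑_t φ(t) ∑_{a=0}^{p-2} g(φω^a) g(ω^{-a})^3 g(φω^{2a}) ω^{-a}(4(1-t)/t)`.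
The term `t = 0` vanishes because `φ(0) = 0`. -/
def gaussCharSum (p : ℕ) [Fact p.Prime] (ζ : ℂ) (ω : MulChar (ZMod p) ℂ) : ℂ :=
  ∑ t : ZMod p, quadChar p t *
    ∑ a ∈ Finset.range (p - 1),
      gSum p ζ (quadChar p * ω ^ a) * gSum p ζ (ω⁻¹ ^ a) ^ 3 *
        gSum p ζ (quadChar p * ω ^ (2 * a)) * (ω⁻¹ ^ a) (4 * (1 - t) / t)

end

/-! Both sides reduce to integer sums of the quadratic character φ = `qc`. Opening the fourth power
and summing over the twist and a common scale gives two quadratic Gauss sums, whence S(4,φ)/p = T -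
2p, where T = `legendreMoment` is the φ-twisted second moment of the Legendre family
(`twistedMoment_four`). Orthogonality of multiplicative characters turns the Gauss sum term into G =
∑ φ(1+m) D(m²), where D = `doubleSum` (`gaussCharSum_eq`).

The heart is G = T + O(p^{3/2}). Clausen's formula (`cubicSum_sq`) expresses D(m²) through the
square of the trace sum of (x-1)(x²-β) at β = 1/(1-m²). The circle identity `sum_circle` replaces
1-m² by a square ν². The cubic at β = 1/ν² then splits and becomes the Legendre cubic with parameter
j = 2/(1+ν), so the sum turns into T (`legendreMoment_eq`). The degenerate points contribute D(1), a
Jacobsthal square and multiples of p.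

The hypergeometric terms are negligible: p²·₂F₁² is a Jacobsthal square, at most 8p by an averaging
argument, and p²·₃F₂(1) is a bilinear sum, at most p^{3/2} by Cauchy–Schwarz (`sq_bilinear_le`),
which also bounds D(1). No Hasse or Weil bound is needed. -/

set_option linter.unusedSectionVars false

/-! ### Elementary sums of the quadratic character. -/

section FiniteFieldSums

variable {F : Type*} [Field F] [Fintype F] [DecidableEq F]

/-- The integer valued quadratic character of a finite field, as a plain function. -/
def qc (x : F) : ℤ := quadraticChar F x

theorem qc_zero : qc (0 : F) = 0 := quadraticChar_zero

theorem qc_one : qc (1 : F) = 1 := map_one (quadraticChar F)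

theorem qc_mul (x y : F) : qc (x * y) = qc x * qc y := map_mul (quadraticChar F) x y

theorem qc_sq {x : F} (hx : x ≠ 0) : qc (x ^ 2) = 1 := quadraticChar_sq_one' hx

theorem qc_mul_self {x : F} (hx : x ≠ 0) : qc x * qc x = 1 := by
  rw [← qc_mul, ← sq, qc_sq hx]

/-- The workhorse: nearly every change of variable below ends by discarding a nonzero square factor.
-/
theorem qc_eq_of_eq_mul_sq {a b t : F} (ht : t ≠ 0) (h : a = b * t ^ 2) : qc a = qc b := by
  rw [h, qc_mul, qc_sq ht, mul_one]

theorem qc_inv (x : F) : qc x⁻¹ = qc x := by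
  by_cases hx : x = 0
  · simp [hx]
  · exact qc_eq_of_eq_mul_sq (t := x⁻¹) (inv_ne_zero hx) (by field_simp)

theorem qc_cases (x : F) : qc x = 0 ∨ qc x = 1 ∨ qc x = -1 := by
  by_cases hx : x = 0
  · left; rw [hx, qc_zero]
  · right; exact quadraticChar_dichotomy hx

theorem abs_qc_le (x : F) : |qc x| ≤ 1 := by
  rcases qc_cases x with h | h | h <;> simp [h]

theorem qc_eq_of_mul_eq_one {x y : F} (h : qc (x * y) = 1) : qc x = qc y := by
  rw [qc_mul] at h
  rcases qc_cases x with h1 | h1 | h1 <;> rcases qc_cases y with h2 | h2 | h2 <;>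
    simp_all

theorem two_ne_zero_of_ringChar (hF : ringChar F ≠ 2) : (2 : F) ≠ 0 :=
  Ring.two_ne_zero hF

theorem sum_qc (hF : ringChar F ≠ 2) : ∑ x : F, qc x = 0 := quadraticChar_sum_zero hF

theorem sum_comp_affine {M : Type*} [AddCommMonoid M] {a : F} (ha : a ≠ 0) (b : F) (f : F → M) :
    ∑ x, f (a * x + b) = ∑ x, f x :=
  ((Equiv.mulLeft₀ a ha).trans (Equiv.addRight b)).sum_comp f

theorem sum_comp_mul {M : Type*} [AddCommMonoid M] {a : F} (ha : a ≠ 0) (f : F → M) :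
    ∑ x, f (a * x) = ∑ x, f x :=
  Equiv.sum_comp (Equiv.mulLeft₀ a ha) f

theorem sum_comp_neg {M : Type*} [AddCommMonoid M] (f : F → M) : ∑ x, f (-x) = ∑ x, f x :=
  Equiv.sum_comp (Equiv.neg F) f

theorem sum_comp_inv {M : Type*} [AddCommMonoid M] (f : F → M) : ∑ x, f x⁻¹ = ∑ x, f x :=
  Equiv.sum_comp (inv_involutive (G := F)).toPerm f

theorem sum_qc_affine (hF : ringChar F ≠ 2) {a : F} (ha : a ≠ 0) (b : F) :
    ∑ x : F, qc (a * x + b) = 0 := by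
  rw [sum_comp_affine ha b qc, sum_qc hF]

/-- Removing the square: the number of `x` with `x ^ 2 = a` is `1 + qc a`. -/
theorem card_sqrts (hF : ringChar F ≠ 2) (a : F) :
    ∑ x : F, (if x ^ 2 = a then (1 : ℤ) else 0) = 1 + qc a := by
  have h := quadraticChar_card_sqrts hF a
  rw [Finset.sum_boole, add_comm, qc, ← h]
  congr 2
  ext x; simp

theorem sum_fiber {ι : Type*} [Fintype ι] (g : ι → F) (f : F → ℤ) :
    ∑ i, f (g i) = ∑ y, f y * ∑ i, (if g i = y then (1 : ℤ) else 0) := by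
  simp_rw [Finset.mul_sum]
  rw [Finset.sum_comm]
  refine Finset.sum_congr rfl fun i _ => ?_
  simp

theorem sum_comp_sq (hF : ringChar F ≠ 2) (f : F → ℤ) :
    ∑ x : F, f (x ^ 2) = ∑ a, f a * (1 + qc a) := by
  rw [sum_fiber (fun x : F => x ^ 2) f]
  exact Finset.sum_congr rfl fun a _ => by rw [card_sqrts hF]

/-- The number of roots of a monic quadratic polynomial. -/
theorem card_roots_quadratic (hF : ringChar F ≠ 2) (b c : F) :
    ∑ x : F, (if x ^ 2 + b * x + c = 0 then (1 : ℤ) else 0) = 1 + qc (b ^ 2 - 4 * c) := by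
  have h2 := two_ne_zero_of_ringChar hF
  rw [← card_sqrts hF (b ^ 2 - 4 * c),
    ← sum_comp_affine h2 b (fun y => if y ^ 2 = b ^ 2 - 4 * c then (1 : ℤ) else 0)]
  refine Finset.sum_congr rfl fun x _ => if_congr ?_ rfl rfl
  have h4 : (4 : F) ≠ 0 := by
    have : (4 : F) = 2 * 2 := by norm_num
    rw [this]; exact mul_ne_zero h2 h2
  constructor
  · intro h; linear_combination 4 * h
  · intro h
    apply mul_left_cancel₀ h4
    linear_combination h

theorem card_roots_quadratic' (hF : ringChar F ≠ 2) {a : F} (ha : a ≠ 0) (b c : F) :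
    ∑ x : F, (if a * x ^ 2 + b * x + c = 0 then (1 : ℤ) else 0) = 1 + qc (b ^ 2 - 4 * a * c) := by
  have h := card_roots_quadratic hF (b / a) (c / a)
  rw [qc_eq_of_eq_mul_sq (a := b ^ 2 - 4 * a * c) (b := (b / a) ^ 2 - 4 * (c / a)) ha
    (by field_simp), ← h]
  refine Finset.sum_congr rfl fun x _ => if_congr ?_ rfl rfl
  have : a * x ^ 2 + b * x + c = a * (x ^ 2 + b / a * x + c / a) := by field_simp
  rw [this, mul_eq_zero]; tauto

/-- Sum of the quadratic character over `(x - a) (x - b)`. -/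
theorem sum_qc_mul (hF : ringChar F ≠ 2) (a b : F) :
    ∑ x : F, qc ((x - a) * (x - b)) = (if a = b then (Fintype.card F : ℤ) else 0) - 1 := by
  split_ifs with h
  · subst h
    have : ∀ x : F, qc ((x - a) * (x - a)) = 1 - if x = a then 1 else 0 := by
      intro x
      split_ifs with hx
      · simp [hx, qc_zero]
      · rw [qc_mul, qc_mul_self (sub_ne_zero.2 hx)]; simp
    simp_rw [this]
    simp
  -- Dividing by (x-a)² leaves 1 + (a-b)/(x-a). At x = a the convention 0⁻¹ = 0 makes this 1, hence
  -- the subtracted term.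
  · have h1 : ∀ x : F, qc ((x - a) * (x - b)) =
        qc (1 + (a - b) * (x - a)⁻¹) - if x = a then 1 else 0 := by
      intro x
      split_ifs with hx
      · simp [hx, qc_zero, qc_one]
      · rw [sub_zero]
        have := sub_ne_zero.2 hx
        exact qc_eq_of_eq_mul_sq this (by field_simp; ring)
    simp_rw [h1]
    rw [Finset.sum_sub_distrib, Finset.sum_ite_eq' Finset.univ a]
    have h2 : ∑ x : F, qc (1 + (a - b) * (x - a)⁻¹) = ∑ x : F, qc x := by
      have e1 := sum_comp_affine (one_ne_zero (α := F)) (-a) (fun y => qc (1 + (a - b) * y⁻¹))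
      have e2 := sum_comp_inv (fun y : F => qc (1 + (a - b) * y))
      have e3 := sum_comp_affine (sub_ne_zero.2 h) 1 qc
      rw [← e3]
      simp only [one_mul, ← sub_eq_add_neg] at e1
      rw [e1, e2]
      exact Finset.sum_congr rfl fun x _ => by rw [add_comm]
    rw [h2, sum_qc hF]; simp

end FiniteFieldSums

/-! ### A finite field Clausen formula. -/

section Clausen

variable {F : Type*} [Field F] [Fintype F] [DecidableEq F]

/-- The trace type sum of the cubic `(x - 1) (x ^ 2 - β)`. -/
def cubicSum (β : F) : ℤ := ∑ x : F, qc ((x - 1) * (x ^ 2 - β))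

/-- The double sum matching the square of `cubicSum` in the finite field Clausen formula. -/
def clausenSum (β : F) : ℤ :=
  ∑ g : F, ∑ h : F, qc (g * (g + 1) * (h * (h + 1)) * (β * g + (1 - β) * h))

/-- For b ≠ 0, φ(ab) = φ(a/b), so the sum just names the ratio z. For a = b = 0 every z qualifies
and ∑ φ = 0 keeps the identity true. Its use is to trade a character of a product for a count of
solutions. -/
theorem qc_mul_eq_sum (hF : ringChar F ≠ 2) (a b : F) :
    qc (a * b) = ∑ z : F, qc z * (if a = z * b then (1 : ℤ) else 0) := by
  by_cases hb : b = 0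
  · subst hb
    by_cases ha : a = 0
    · simp [ha, sum_qc hF, qc_zero]
    · simp [ha, qc_zero]
  · rw [Finset.sum_eq_single (a / b)]
    · rw [if_pos (by field_simp), mul_one]
      exact qc_eq_of_eq_mul_sq hb (by field_simp)
    · intro z _ hz
      rw [if_neg, mul_zero]
      intro h; apply hz; rw [h]; field_simp
    · simp

/-- The number of solutions of `Q(X) = z Q(tX)` for `Q(X) = X ^ 2 + 2 X + b`. -/
theorem card_quadratic_ratio (hF : ringChar F ≠ 2) (b : F) {t : F} (ht : t ≠ 0) (z : F) :
    ∑ X : F, (if X ^ 2 + 2 * X + b = z * ((t * X) ^ 2 + 2 * (t * X) + b) then (1 : ℤ) else 0) =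
      1 + qc ((1 - z * t) ^ 2 - b * (1 - z) * (1 - z * t ^ 2)) +
        (if z = (t ^ 2)⁻¹ then ((if t = 1 then (Fintype.card F : ℤ) else 0) - 1) else 0) := by
  have h2 := two_ne_zero_of_ringChar hF
  have e : ∀ X : F, (X ^ 2 + 2 * X + b = z * ((t * X) ^ 2 + 2 * (t * X) + b)) ↔
      ((1 - z * t ^ 2) * X ^ 2 + (2 * (1 - z * t)) * X + b * (1 - z) = 0) := by
    intro X
    constructor
    · intro h; linear_combination h
    · intro h; linear_combination h
  simp_rw [e]
  -- For this z the leading coefficient vanishes: one root if t ≠ 1, all of F if t = 1. The last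
  -- summand corrects the discriminant count accordingly.
  by_cases hz : z = (t ^ 2)⁻¹
  · rw [if_pos hz]
    have hzt : z * t ^ 2 = 1 := by rw [hz]; field_simp
    have hzt' : z * t = t⁻¹ := by rw [hz]; field_simp
    simp_rw [hzt, sub_self, zero_mul, zero_add, mul_zero, sub_zero, hzt']
    by_cases h1 : t = 1
    · subst h1
      have : z = 1 := by simpa using hz
      subst this
      simp [qc_zero]
    · have h3 : (1 : F) - t⁻¹ ≠ 0 := by
        intro h; apply h1; field_simp at h; linear_combination h
      rw [if_neg h1, qc_sq h3]
      rw [Finset.sum_eq_single (-(b * (1 - z)) / (2 * (1 - t⁻¹)))]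
      · rw [if_pos]; · ring
        rw [mul_div_cancel₀ _ (mul_ne_zero h2 h3)]; ring
      · intro X _ hX
        rw [if_neg]
        intro h; apply hX
        rw [eq_div_iff (mul_ne_zero h2 h3)]; linear_combination h
      · simp
  · rw [if_neg hz, add_zero]
    have hzt : (1 : F) - z * t ^ 2 ≠ 0 := by
      intro h; apply hz
      exact eq_inv_of_mul_eq_one_left (by linear_combination -h)
    rw [card_roots_quadratic' hF hzt]
    congr 1
    exact qc_eq_of_eq_mul_sq h2 (by ring)

theorem cubicSum_eq (β : F) : cubicSum β = ∑ X : F, qc (X * (X ^ 2 + 2 * X + (1 - β))) := by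
  rw [cubicSum, ← sum_comp_affine (one_ne_zero (α := F)) 1]
  exact Finset.sum_congr rfl fun x _ => by congr 1; ring

/-- In the double sum over X and Y put Y = tX; the factor X·tX is φ(t) up to a square. For X = 0
both sides vanish. -/
theorem cubicSum_sq_eq (hF : ringChar F ≠ 2) {β : F} (hβ : β ≠ 1) :
    cubicSum β ^ 2 = ∑ t : F, ∑ X : F, qc t * qc ((X ^ 2 + 2 * X + (1 - β)) *
      ((t * X) ^ 2 + 2 * (t * X) + (1 - β))) := by
  rw [cubicSum_eq, sq, Finset.sum_mul_sum]
  conv_rhs => rw [Finset.sum_comm]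
  refine Finset.sum_congr rfl fun X _ => ?_
  by_cases hX : X = 0
  · subst hX
    have hb : (1 : F) - β ≠ 0 := sub_ne_zero.2 (Ne.symm hβ)
    simp [qc_zero, ← Finset.sum_mul, sum_qc hF]
  · conv_lhs => rw [← sum_comp_mul hX]
    refine Finset.sum_congr rfl fun t _ => ?_
    rw [← qc_mul, ← qc_mul]
    exact qc_eq_of_eq_mul_sq hX (by ring)

/-- Sum over X with the ratio z of the two quadratics fixed. The constant 1 in the root count dies
against ∑ φ(z) = 0; the degenerate z = t⁻² leaves ∑ φ(t)(q·[t = 1] - 1) = q, which is the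
`Fintype.card F` in Clausen's formula. -/
theorem cubicSum_sq_eq' (hF : ringChar F ≠ 2) {β : F} (hβ : β ≠ 1) :
    cubicSum β ^ 2 = Fintype.card F + ∑ t : F, ∑ z : F,
      qc t * qc z * qc ((1 - z * t) ^ 2 - (1 - β) * (1 - z) * (1 - z * t ^ 2)) := by
  have hb : (1 : F) - β ≠ 0 := sub_ne_zero.2 (Ne.symm hβ)
  rw [cubicSum_sq_eq hF hβ]
  have key : ∀ t : F, ∑ X : F, qc t * qc ((X ^ 2 + 2 * X + (1 - β)) *
      ((t * X) ^ 2 + 2 * (t * X) + (1 - β))) =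
      qc t * ((if t = 1 then (Fintype.card F : ℤ) else 0) - 1) + ∑ z : F,
      qc t * qc z * qc ((1 - z * t) ^ 2 - (1 - β) * (1 - z) * (1 - z * t ^ 2)) := by
    intro t
    by_cases ht : t = 0
    · simp [ht, qc_zero]
    · simp_rw [qc_mul_eq_sum hF (_ ^ 2 + _ * _ + _), ← Finset.mul_sum, mul_assoc (qc t)]
      rw [Finset.sum_comm]
      simp_rw [← Finset.mul_sum, card_quadratic_ratio hF _ ht, mul_add, Finset.sum_add_distrib,
        mul_one, sum_qc hF]
      rw [zero_add, add_comm, mul_add]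
      congr 2
      simp only [mul_ite, mul_zero, Finset.sum_ite_eq', Finset.mem_univ, if_true]
      rw [qc_inv, qc_sq ht]; ring
  simp_rw [key]
  rw [Finset.sum_add_distrib]
  congr 1
  simp_rw [mul_sub, Finset.sum_sub_distrib, mul_one, sum_qc hF]
  simp [qc_one]

/-- Reciprocal sums `t + 1/t - 2 = 4 g`. -/
theorem card_reciprocal_sum (hF : ringChar F ≠ 2) (g : F) :
    ∑ t : F, (if t ≠ 0 ∧ (t + t⁻¹ - 2) / 4 = g then (1 : ℤ) else 0) = 1 + qc (g * (g + 1)) := by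
  have h2 := two_ne_zero_of_ringChar hF
  have h4 : (4 : F) ≠ 0 := by
    have : (4 : F) = 2 * 2 := by norm_num
    rw [this]; exact mul_ne_zero h2 h2
  have h := card_roots_quadratic hF (-(4 * g + 2)) 1
  rw [← qc_eq_of_eq_mul_sq (a := (-(4 * g + 2)) ^ 2 - 4 * 1) (b := g * (g + 1)) h4
    (by ring), ← h]
  refine Finset.sum_congr rfl fun t _ => if_congr ?_ rfl rfl
  constructor
  · rintro ⟨ht, rfl⟩
    field_simp; ring
  · intro h
    have ht : t ≠ 0 := by rintro rfl; simp at h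
    refine ⟨ht, ?_⟩
    field_simp
    linear_combination h

theorem sum_reciprocal_sum (hF : ringChar F ≠ 2) (f : F → ℤ) :
    ∑ t : F, (if t ≠ 0 then f ((t + t⁻¹ - 2) / 4) else 0) =
      ∑ g : F, f g * (1 + qc (g * (g + 1))) := by
  simp_rw [← card_reciprocal_sum hF, Finset.mul_sum]
  rw [Finset.sum_comm]
  refine Finset.sum_congr rfl fun t _ => ?_
  by_cases ht : t = 0 <;> simp [ht]

/-- Clausen's formula: the square of the cubic sum as a double sum. -/
theorem cubicSum_sq (hF : ringChar F ≠ 2) {β : F} (h0 : β ≠ 0) (h1 : β ≠ 1) :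
    cubicSum β ^ 2 = Fintype.card F + clausenSum β := by
  have h2 := two_ne_zero_of_ringChar hF
  have h4 : (4 : F) ≠ 0 := by
    have : (4 : F) = 2 * 2 := by norm_num
    rw [this]; exact mul_ne_zero h2 h2
  have hb : (1 : F) - β ≠ 0 := sub_ne_zero.2 (Ne.symm h1)
  rw [cubicSum_sq_eq' hF h1]
  congr 1
  have e : ∀ t : F, ∑ z : F,
      qc t * qc z * qc ((1 - z * t) ^ 2 - (1 - β) * (1 - z) * (1 - z * t ^ 2)) =
      if t ≠ 0 then ∑ w : F, (if w ≠ 0 then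
        qc (β * ((w + w⁻¹ - 2) / 4) + (1 - β) * ((t + t⁻¹ - 2) / 4)) else 0) else 0 := by
    intro t
    by_cases ht : t = 0
    · simp [ht, qc_zero]
    · rw [if_pos ht]
      -- With z = w/t the discriminant separates into w times β(w + 1/w - 2) + (1-β)(t + 1/t - 2),
      -- linear in the two reciprocal sums.
      conv_lhs => rw [← sum_comp_mul (inv_ne_zero ht)]
      refine (Finset.sum_congr rfl fun z _ => ?_)
      by_cases hz : z = 0
      · simp [hz, qc_zero]
      · rw [if_pos hz, ← qc_mul, ← qc_mul]
        refine qc_eq_of_eq_mul_sq (t := 2 * z) (mul_ne_zero h2 hz) ?_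
        field_simp
        ring
  simp_rw [e]
  rw [sum_reciprocal_sum hF (fun h => ∑ w : F, (if w ≠ 0 then
        qc (β * ((w + w⁻¹ - 2) / 4) + (1 - β) * h) else 0))]
  have e2 : ∀ h : F, ∑ w : F, (if w ≠ 0 then
        qc (β * ((w + w⁻¹ - 2) / 4) + (1 - β) * h) else 0) =
        ∑ g : F, qc (g * (g + 1)) * qc (β * g + (1 - β) * h) := by
    intro h
    rw [sum_reciprocal_sum hF (fun g => qc (β * g + (1 - β) * h))]
    simp_rw [mul_add, mul_one, Finset.sum_add_distrib, sum_qc_affine hF h0, zero_add]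
    exact Finset.sum_congr rfl fun g _ => mul_comm _ _
  simp_rw [e2]
  rw [Finset.sum_congr rfl fun h _ => mul_one_add _ _, Finset.sum_add_distrib]
  have e3 : ∑ h : F, ∑ g : F, qc (g * (g + 1)) * qc (β * g + (1 - β) * h) = 0 := by
    rw [Finset.sum_comm]
    refine Finset.sum_eq_zero fun g _ => ?_
    rw [← Finset.mul_sum]
    simp_rw [add_comm (β * g)]
    rw [sum_qc_affine hF hb, mul_zero]
  rw [e3, zero_add, clausenSum, Finset.sum_comm]
  refine Finset.sum_congr rfl fun h _ => ?_
  rw [Finset.sum_mul]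
  refine Finset.sum_congr rfl fun g _ => ?_
  rw [← qc_mul, ← qc_mul]
  congr 1; ring

end Clausen

/-! ### Comparing the `doubleSum` average with the Legendre moment. -/

section Correlation

variable {F : Type*} [Field F] [Fintype F] [DecidableEq F]

/-- The Legendre family sum. -/
def legendreSum (j : F) : ℤ := ∑ k : F, qc (k * (1 + k) * (1 + j * k))

/-- The Jacobsthal sum attached to `x (x ^ 2 - d)`. -/
def jacobsthalSum (d : F) : ℤ := ∑ x : F, qc (x * (x ^ 2 - d))

/-- The second moment of the Legendre family twisted by the quadratic character. -/
def legendreMoment (F : Type*) [Field F] [Fintype F] [DecidableEq F] : ℤ :=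
  ∑ j : F, qc j * legendreSum j ^ 2

/-- A `₃F₂` type double sum. -/
def doubleSum (y : F) : ℤ :=
  ∑ c : F, ∑ r : F, qc (c * (c + 4)) * (qc (-r * (1 - 4 * r)) * qc (1 + c * y * r))

theorem four_ne_zero_of_ringChar (hF : ringChar F ≠ 2) : (4 : F) ≠ 0 := by
  have h2 := two_ne_zero_of_ringChar hF
  have : (4 : F) = 2 * 2 := by norm_num
  rw [this]; exact mul_ne_zero h2 h2

theorem legendreSum_two (hF : ringChar F ≠ 2) : legendreSum (2 : F) = jacobsthalSum (1 : F) := by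
  have h2 := two_ne_zero_of_ringChar hF
  rw [legendreSum, jacobsthalSum]
  conv_rhs => rw [← sum_comp_affine h2 1]
  exact Finset.sum_congr rfl fun k _ => (qc_eq_of_eq_mul_sq h2 (by ring)).symm

theorem jacobsthalSum_sq_mul {t : F} (ht : t ≠ 0) :
    jacobsthalSum (t ^ 2) ^ 2 = jacobsthalSum (1 : F) ^ 2 := by
  have : jacobsthalSum (t ^ 2) = qc t * jacobsthalSum (1 : F) := by
    rw [jacobsthalSum, jacobsthalSum, ← sum_comp_mul ht, Finset.mul_sum]
    refine Finset.sum_congr rfl fun x _ => ?_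
    rw [← qc_mul]
    exact qc_eq_of_eq_mul_sq ht (by ring)
  rw [this, mul_pow, sq (qc t), qc_mul_self ht, one_mul]

theorem sum_qc_mul_neg (hF : ringChar F ≠ 2) (a b : F) :
    ∑ x : F, qc ((a - x) * (b - x)) = (if a = b then (Fintype.card F : ℤ) else 0) - 1 := by
  rw [← sum_qc_mul hF]
  exact Finset.sum_congr rfl fun x _ => by congr 1; ring

theorem sum_jacobsthalSum_sq (hF : ringChar F ≠ 2) :
    ∑ d : F, jacobsthalSum d ^ 2 ≤ 2 * (Fintype.card F : ℤ) ^ 2 := by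
  have e : ∑ d : F, jacobsthalSum d ^ 2 = ∑ x : F, ∑ y : F, qc x * qc y *
      ((if x ^ 2 = y ^ 2 then (Fintype.card F : ℤ) else 0) - 1) := by
    simp_rw [← sum_qc_mul_neg hF, jacobsthalSum, sq (∑ x : F, _), Finset.sum_mul_sum,
      Finset.mul_sum]
    rw [Finset.sum_comm]
    refine Finset.sum_congr rfl fun x _ => ?_
    rw [Finset.sum_comm]
    refine Finset.sum_congr rfl fun y _ => Finset.sum_congr rfl fun d _ => ?_
    simp_rw [← qc_mul]
    congr 1; ring
  rw [e]
  simp_rw [mul_sub, Finset.sum_sub_distrib, mul_one, ← Finset.sum_mul_sum, sum_qc hF]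
  rw [mul_zero, sub_zero]
  -- Only the pairs y = ±x survive, and each contributes at most q.
  have : ∀ x y : F, qc x * qc y * (if x ^ 2 = y ^ 2 then (Fintype.card F : ℤ) else 0) ≤
      Fintype.card F * ((if y = x then 1 else 0) + (if y = -x then 1 else 0)) := by
    intro x y
    have hq : (0 : ℤ) ≤ Fintype.card F := by positivity
    by_cases h : x ^ 2 = y ^ 2
    · rw [if_pos h, mul_comm]
      refine mul_le_mul_of_nonneg_left ?_ hq
      have h1 : qc x * qc y ≤ 1 := by
        rw [← qc_mul]; exact (le_abs_self _).trans (abs_qc_le _)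
      rcases sq_eq_sq_iff_eq_or_eq_neg.1 h.symm with h | h
      · rw [if_pos h]; split_ifs <;> omega
      · rw [if_pos h]; split_ifs <;> omega
    · rw [if_neg h, mul_zero]; positivity
  refine (Finset.sum_le_sum fun x _ => Finset.sum_le_sum fun y _ => this x y).trans ?_
  simp_rw [← Finset.mul_sum, Finset.sum_add_distrib, Finset.sum_ite_eq']
  simp
  linarith [sq (Fintype.card F : ℤ)]

/-- The twists d = t² with t ≠ 0 all share the same square, so (q-1)·J(1)² is at most twice the full
second moment, that is 4q²; then q ≤ 2(q-1). -/
theorem jacobsthalSum_one_sq_le (hF : ringChar F ≠ 2) :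
    jacobsthalSum (1 : F) ^ 2 ≤ 8 * Fintype.card F := by
  have h1 : ((Fintype.card F : ℤ) - 1) * jacobsthalSum (1 : F) ^ 2 ≤
      ∑ t : F, jacobsthalSum (t ^ 2) ^ 2 := by
    rw [← Finset.add_sum_erase _ _ (Finset.mem_univ (0 : F)),
      Finset.sum_congr rfl fun t ht => jacobsthalSum_sq_mul (Finset.ne_of_mem_erase ht)]
    rw [Finset.sum_const, Finset.card_erase_of_mem (Finset.mem_univ _), Finset.card_univ,
      nsmul_eq_mul, Nat.cast_sub Fintype.card_pos]
    push_cast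
    nlinarith [sq_nonneg (jacobsthalSum ((0 : F) ^ 2))]
  rw [sum_comp_sq hF (fun d => jacobsthalSum d ^ 2)] at h1
  have h2 : ∑ a : F, jacobsthalSum a ^ 2 * (1 + qc a) ≤ ∑ a : F, jacobsthalSum a ^ 2 * 2 := by
    refine Finset.sum_le_sum fun a _ => mul_le_mul_of_nonneg_left ?_ (sq_nonneg _)
    have := (le_abs_self _).trans (abs_qc_le a)
    linarith
  rw [← Finset.sum_mul] at h2
  have h3 := sum_jacobsthalSum_sq hF
  have h4 : (2 : ℤ) ≤ Fintype.card F := by exact_mod_cast Fintype.one_lt_card (α := F)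
  by_contra! h
  nlinarith

theorem qc_four (hF : ringChar F ≠ 2) : qc (4 : F) = 1 := by
  rw [qc_eq_of_eq_mul_sq (b := 1) (two_ne_zero_of_ringChar hF) (by norm_num), qc_one]

/-- Rotation of the circle `ν ^ 2 + m ^ 2 = 1`. -/
theorem sum_circle (hF : ringChar F ≠ 2) (f : F → ℤ) :
    ∑ m : F, qc (1 + m) * f (1 - m ^ 2) = ∑ ν : F, qc (2 * (1 + ν)) * f (ν ^ 2) := by
  have h2 := two_ne_zero_of_ringChar hF
  -- On the circle 2(1+ν)(1+m) = (1+ν+m)², so the two characters agree except where one factor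
  -- vanishes, at (ν,m) = (-1,0) and (0,-1).
  have hcirc : ∀ ν m : F, ν ^ 2 + m ^ 2 = 1 →
      qc (2 * (1 + ν)) + (if ν = -1 then 1 else 0) = qc (1 + m) + (if m = -1 then qc (2 : F) else 0) := by
    intro ν m h
    by_cases h1 : ν = -1
    · subst h1
      have : m = 0 := by
        have : m ^ 2 = 0 := by linear_combination h
        simpa using this
      subst this
      simp [qc_zero, qc_one]
    · by_cases h3 : m = -1
      · subst h3
        have : ν = 0 := by
          have : ν ^ 2 = 0 := by linear_combination h
          simpa using this
        subst this
        simp [qc_zero]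
      · rw [if_neg h1, if_neg h3, add_zero, add_zero]
        apply qc_eq_of_mul_eq_one
        have e : 2 * (1 + ν) * (1 + m) = (1 + ν + m) ^ 2 := by linear_combination (-1 : F) * h
        have n1 : (1 : F) + ν ≠ 0 := fun h' => h1 (by linear_combination h')
        have n3 : (1 : F) + m ≠ 0 := fun h' => h3 (by linear_combination h')
        have : (1 + ν + m) ≠ 0 := by
          intro h0
          rw [h0] at e
          exact mul_ne_zero (mul_ne_zero h2 n1) n3 (by simpa using e)
        rw [e, qc_sq this]
  -- Averaging over ±m yields φ(1+m) + φ(1-m) = φ(1+m)(1 + φ(1-m²)) for m ≠ -1, and the last factor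
  -- counts the ν above m.
  have h1 : 2 * ∑ m : F, qc (1 + m) * f (1 - m ^ 2) = ∑ m : F, ∑ ν : F,
      if ν ^ 2 + m ^ 2 = 1 then (qc (1 + m) + (if m = -1 then qc (2 : F) else 0)) * f (1 - m ^ 2)
      else 0 := by
    rw [two_mul]
    nth_rewrite 2 [← sum_comp_neg]
    rw [← Finset.sum_add_distrib]
    refine Finset.sum_congr rfl fun m _ => ?_
    have e : ∀ ν : F, (ν ^ 2 + m ^ 2 = 1) ↔ (ν ^ 2 = 1 - m ^ 2) := fun ν =>
      ⟨fun h => by linear_combination h, fun h => by linear_combination h⟩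
    have := card_sqrts hF (1 - m ^ 2)
    simp_rw [e]
    calc _ = (qc (1 + m) + (if m = -1 then qc (2 : F) else 0)) * f (1 - m ^ 2) *
          (1 + qc (1 - m ^ 2)) := by
          by_cases hm : m = -1
          · subst hm
            simp [qc_zero]; left; norm_num
          · have hm' : (1 : F) + m ≠ 0 := fun h' => hm (by linear_combination h')
            have e : qc (1 + -m) = qc (1 + m) * qc (1 - m ^ 2) := by
              rw [← qc_mul]; exact (qc_eq_of_eq_mul_sq hm' (by ring)).symm
            rw [if_neg hm, e, neg_sq]; ring
      _ = _ := by
          rw [← this, Finset.mul_sum]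
          exact Finset.sum_congr rfl fun ν _ => by split_ifs <;> simp
  have h3 : 2 * ∑ ν : F, qc (2 * (1 + ν)) * f (ν ^ 2) = ∑ ν : F, ∑ m : F,
      if ν ^ 2 + m ^ 2 = 1 then (qc (2 * (1 + ν)) + (if ν = -1 then 1 else 0)) * f (ν ^ 2)
      else 0 := by
    rw [two_mul]
    nth_rewrite 2 [← sum_comp_neg]
    rw [← Finset.sum_add_distrib]
    refine Finset.sum_congr rfl fun ν _ => ?_
    have e : ∀ m : F, (ν ^ 2 + m ^ 2 = 1) ↔ (m ^ 2 = 1 - ν ^ 2) := fun m =>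
      ⟨fun h => by linear_combination h, fun h => by linear_combination h⟩
    have := card_sqrts hF (1 - ν ^ 2)
    simp_rw [e]
    calc _ = (qc (2 * (1 + ν)) + (if ν = -1 then 1 else 0)) * f (ν ^ 2) *
          (1 + qc (1 - ν ^ 2)) := by
          by_cases hm : ν = -1
          · subst hm
            have : (2 : F) * (1 + 1) = 4 := by norm_num
            simp [qc_zero, this, qc_four hF]
          · have hm' : (1 : F) + ν ≠ 0 := fun h' => hm (by linear_combination h')
            have e : qc (2 * (1 + -ν)) = qc (2 * (1 + ν)) * qc (1 - ν ^ 2) := by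
              rw [← qc_mul]; exact (qc_eq_of_eq_mul_sq hm' (by ring)).symm
            rw [if_neg hm, e, neg_sq]; ring
      _ = _ := by
          rw [← this, Finset.mul_sum]
          exact Finset.sum_congr rfl fun m _ => by split_ifs <;> simp
  have h4 : 2 * ∑ m : F, qc (1 + m) * f (1 - m ^ 2) = 2 * ∑ ν : F, qc (2 * (1 + ν)) * f (ν ^ 2) := by
    rw [h1, h3, Finset.sum_comm]
    refine Finset.sum_congr rfl fun ν _ => Finset.sum_congr rfl fun m _ => ?_
    by_cases h : ν ^ 2 + m ^ 2 = 1
    · have e : 1 - m ^ 2 = ν ^ 2 := by linear_combination -h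
      rw [if_pos h, if_pos h, e, hcirc ν m h]
    · rw [if_neg h, if_neg h]
  linarith

/-- Substitute c = 4h and r = -1/(4g); then 1 + cyr becomes (g - yh)/g, and g - yh is (1-y)(βg +
(1-β)h) for β = 1/(1-y). -/
theorem doubleSum_eq_clausenSum (hF : ringChar F ≠ 2) {y : F} (hy : y ≠ 1) :
    doubleSum y = qc (1 - y) * clausenSum (1 - y)⁻¹ := by
  have h2 := two_ne_zero_of_ringChar hF
  have h4 := four_ne_zero_of_ringChar hF
  have hy' : (1 : F) - y ≠ 0 := sub_ne_zero.2 (Ne.symm hy)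
  rw [doubleSum, clausenSum]
  conv_rhs => rw [Finset.sum_comm]
  rw [← sum_comp_mul h4, Finset.mul_sum]
  refine Finset.sum_congr rfl fun h _ => ?_
  conv_lhs => rw [← sum_comp_inv, ← sum_comp_mul (neg_ne_zero.2 h4)]
  rw [Finset.mul_sum]
  refine Finset.sum_congr rfl fun g _ => ?_
  by_cases hg : g = 0
  · simp [hg, qc_zero]
  · simp_rw [← qc_mul]
    refine qc_eq_of_eq_mul_sq (t := 2 * (g ^ 2)⁻¹)
      (mul_ne_zero h2 (inv_ne_zero (pow_ne_zero 2 hg))) ?_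
    field_simp
    ring

theorem cubicSum_zero_sq (hF : ringChar F ≠ 2) : cubicSum (0 : F) ^ 2 = 1 := by
  have : ∀ x : F, qc ((x - 1) * (x ^ 2 - 0)) = qc (x - 1) - if x = 0 then qc (-1 : F) else 0 := by
    intro x
    split_ifs with hx
    · simp [hx, qc_zero]
    · rw [sub_zero, sub_zero]; exact qc_eq_of_eq_mul_sq hx rfl
  rw [cubicSum]
  simp_rw [this]
  rw [Finset.sum_sub_distrib]
  have e := sum_qc_affine hF (one_ne_zero (α := F)) (-1)
  simp only [one_mul, ← sub_eq_add_neg] at e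
  rw [e]
  simp [sq, qc_mul_self]

theorem cubicSum_one_sq (hF : ringChar F ≠ 2) : cubicSum (1 : F) ^ 2 = 1 := by
  have h2 := two_ne_zero_of_ringChar hF
  have : ∀ x : F, qc ((x - 1) * (x ^ 2 - 1)) = qc (x + 1) - if x = 1 then qc (2 : F) else 0 := by
    intro x
    split_ifs with hx
    · rw [hx]; norm_num [qc_zero]
    · rw [sub_zero]; exact qc_eq_of_eq_mul_sq (sub_ne_zero.2 hx) (by ring)
  rw [cubicSum]
  simp_rw [this]
  rw [Finset.sum_sub_distrib]
  have e := sum_qc_affine hF (one_ne_zero (α := F)) 1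
  simp only [one_mul] at e
  rw [e]
  simp [sq, qc_mul_self h2]

theorem sum_qc_quadratic_form (hF : ringChar F ≠ 2) (a : F) {b : F} (hb : b ≠ 0) :
    ∑ x : F, qc (a * x * (x + b)) = -qc a := by
  have : ∀ x : F, qc (a * x * (x + b)) = qc a * qc ((x - 0) * (x - -b)) := by
    intro x; rw [← qc_mul]; congr 1; ring
  simp_rw [this, ← Finset.mul_sum, sum_qc_mul hF]
  rw [if_neg (by simpa using hb)]; ring

theorem doubleSum_zero (hF : ringChar F ≠ 2) : doubleSum (0 : F) = 1 := by
  have h4 := four_ne_zero_of_ringChar hF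
  have e1 : ∑ c : F, qc (c * (c + 4)) = -1 := by
    have := sum_qc_quadratic_form hF (1 : F) h4
    simpa [qc_one] using this
  have e2 : ∑ r : F, qc (-r * (1 - 4 * r)) = -1 := by
    have := sum_qc_quadratic_form hF (4 : F) (b := -4⁻¹) (by simpa using h4)
    rw [qc_four hF] at this
    rw [← this]
    refine Finset.sum_congr rfl fun r _ => ?_
    congr 1; field_simp; ring
  simp_rw [doubleSum, mul_zero, zero_mul, add_zero, qc_one, mul_one, ← Finset.mul_sum, e2,
    ← Finset.sum_mul, e1]
  norm_num

theorem sum_qc_doubleSum (hF : ringChar F ≠ 2) :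
    ∑ m : F, qc (1 + m) * doubleSum (m ^ 2) =
      ∑ m : F, qc (1 + m) * cubicSum (1 - m ^ 2)⁻¹ ^ 2 + qc (2 : F) * doubleSum (1 : F) +
        Fintype.card F * (1 + qc (2 : F)) - qc (2 : F) := by
  have h2 := two_ne_zero_of_ringChar hF
  have h11 : (1 : F) ≠ -1 := fun h => h2 (by linear_combination h)
  -- Generically φ(1+m)φ(1-m²) = φ(1-m). Clausen fails at β = 1 (m = 0) and β is undefined at m =
  -- ±1, read as 0 through 0⁻¹ = 0; the indicators repair these points.
  have key : ∀ m : F, qc (1 + m) * doubleSum (m ^ 2) =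
      qc (1 + -m) * (cubicSum (1 - (-m) ^ 2)⁻¹ ^ 2 - Fintype.card F) +
      ((if m = 0 then (Fintype.card F : ℤ) else 0) +
      (if m = 1 then qc (2 : F) * doubleSum (1 : F) else 0) +
      (if m = -1 then qc (2 : F) * ((Fintype.card F : ℤ) - 1) else 0)) := by
    intro m
    by_cases h0 : m = 0
    · subst h0
      simp [qc_one, doubleSum_zero hF, cubicSum_one_sq hF]
    by_cases h1 : m = 1
    · subst h1
      simp [h11, qc_zero]; left; norm_num
    by_cases hm : m = -1
    · subst hm
      have e : (1 : F) + 1 = 2 := by norm_num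
      simp [h11.symm, qc_zero, cubicSum_zero_sq hF, e]
      ring
    simp only [if_neg h0, if_neg h1, if_neg hm, add_zero, neg_sq]
    have n1 : (1 : F) + m ≠ 0 := fun h => hm (by linear_combination h)
    have n2 : m ^ 2 ≠ 1 := by
      intro h; rw [sq] at h; rcases mul_self_eq_one_iff.1 h with h | h
      · exact h1 h
      · exact hm h
    have n3 : (1 : F) - m ^ 2 ≠ 0 := sub_ne_zero.2 n2.symm
    rw [doubleSum_eq_clausenSum hF n2, cubicSum_sq hF (inv_ne_zero n3)]
    · rw [← mul_assoc, ← qc_mul, add_sub_cancel_left]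
      congr 1
      exact qc_eq_of_eq_mul_sq n1 (by ring)
    · intro h
      rw [inv_eq_one] at h
      exact h0 (by simpa using h)
  rw [Finset.sum_congr rfl fun m _ => key m, Finset.sum_add_distrib,
    sum_comp_neg (fun m : F => qc (1 + m) * (cubicSum (1 - m ^ 2)⁻¹ ^ 2 - Fintype.card F))]
  simp_rw [mul_sub, Finset.sum_sub_distrib, ← Finset.sum_mul]
  have e := sum_qc_affine hF (one_ne_zero (α := F)) 1
  simp only [one_mul, add_comm _ (1 : F)] at e
  rw [e]
  simp only [Finset.sum_add_distrib, Finset.sum_ite_eq', Finset.mem_univ, if_true]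
  ring

/-- Now x² - ν⁻² splits, and x = -(2k+1)/ν carries the roots k = 0, -1 and -(1+ν)/2 of the Legendre
cubic to -1/ν, 1/ν and 1. -/
theorem cubicSum_sq_eq_legendreSum (hF : ringChar F ≠ 2) {ν : F} (h0 : ν ≠ 0) (h1 : ν ≠ -1) :
    cubicSum (ν ^ 2)⁻¹ ^ 2 = legendreSum (2 * (1 + ν)⁻¹) ^ 2 := by
  have h2 := two_ne_zero_of_ringChar hF
  have n1 : (1 : F) + ν ≠ 0 := fun h => h1 (by linear_combination h)
  have e : cubicSum (ν ^ 2)⁻¹ = qc (-(1 + ν⁻¹)) * legendreSum (2 * (1 + ν)⁻¹) := by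
    have hν : -(2 * ν⁻¹) ≠ 0 := neg_ne_zero.2 (mul_ne_zero h2 (inv_ne_zero h0))
    rw [cubicSum, legendreSum, ← sum_comp_affine hν (-ν⁻¹), Finset.mul_sum]
    refine Finset.sum_congr rfl fun k _ => ?_
    rw [← qc_mul]
    refine qc_eq_of_eq_mul_sq (t := 2 * ν⁻¹) (neg_ne_zero.1 hν) ?_
    field_simp
    ring
  have n2 : -(1 + ν⁻¹) ≠ 0 := by
    have : -(1 + ν⁻¹) = -(1 + ν) * ν⁻¹ := by field_simp; ring
    rw [this]; exact mul_ne_zero (neg_ne_zero.2 n1) (inv_ne_zero h0)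
  rw [e, mul_pow, sq (qc _), qc_mul_self n2, one_mul]

/-- Parametrize j = 2/(1+ν). At ν = 0 the convention 0⁻¹ = 0 gives `cubicSum 0 ^ 2 = 1` where the
moment has L(2)², hence the correction. -/
theorem legendreMoment_eq (hF : ringChar F ≠ 2) :
    legendreMoment F = ∑ ν : F, qc (2 * (1 + ν)) * cubicSum (ν ^ 2)⁻¹ ^ 2 +
      qc (2 : F) * (legendreSum (2 : F) ^ 2 - 1) := by
  have h2 := two_ne_zero_of_ringChar hF
  have e3 := sum_comp_affine (one_ne_zero (α := F)) 1
    (fun u : F => qc (2 * u⁻¹) * legendreSum (2 * u⁻¹) ^ 2)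
  have key : ∀ ν : F, qc (2 * (1 * ν + 1)⁻¹) * legendreSum (2 * (1 * ν + 1)⁻¹) ^ 2 =
      qc (2 * (1 + ν)) * cubicSum (ν ^ 2)⁻¹ ^ 2 +
      (if ν = 0 then qc (2 : F) * (legendreSum (2 : F) ^ 2 - 1) else 0) := by
    intro ν
    rw [one_mul, add_comm ν 1]
    have : qc (2 * (1 + ν)⁻¹) = qc (2 * (1 + ν)) := by rw [qc_mul, qc_inv, ← qc_mul]
    rw [this]
    by_cases h0 : ν = 0
    · subst h0
      simp [cubicSum_zero_sq hF]; ring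
    · by_cases h1 : ν = -1
      · subst h1; simp [qc_zero]
      · rw [if_neg h0, cubicSum_sq_eq_legendreSum hF h0 h1, add_zero]
  rw [legendreMoment, ← sum_comp_mul h2, ← sum_comp_inv, ← e3,
    Finset.sum_congr rfl fun ν _ => key ν, Finset.sum_add_distrib]
  simp

/-- Cauchy-Schwarz bound for bilinear sums with a quadratic character kernel. -/
theorem sq_bilinear_le (hF : ringChar F ≠ 2) {κ : F} (hκ : κ ≠ 0) (α β : F → ℤ)
    (hα : ∀ a, |α a| ≤ 1) (hβ : ∀ b, |β b| ≤ 1) (hβ0 : β 0 = 0) :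
    (∑ a, ∑ b, α a * (β b * qc (1 + a * κ * b))) ^ 2 ≤ (Fintype.card F : ℤ) ^ 3 := by
  have hsq : ∀ z : ℤ, |z| ≤ 1 → z ^ 2 ≤ 1 := fun z hz => by
    rw [← sq_abs]; nlinarith [abs_nonneg z]
  have h1 : (∑ a, ∑ b, α a * (β b * qc (1 + a * κ * b))) ^ 2 ≤
      (∑ a, α a ^ 2) * ∑ a, (∑ b, β b * qc (1 + a * κ * b)) ^ 2 := by
    simp_rw [← Finset.mul_sum]
    exact Finset.sum_mul_sq_le_sq_mul_sq _ _ _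
  have h2 : ∑ a, α a ^ 2 ≤ (Fintype.card F : ℤ) := by
    refine (Finset.sum_le_sum fun a _ => hsq _ (hα a)).trans ?_
    simp
  have h3 : ∑ a, (∑ b, β b * qc (1 + a * κ * b)) ^ 2 ≤ (Fintype.card F : ℤ) ^ 2 := by
    have e : ∑ a, (∑ b, β b * qc (1 + a * κ * b)) ^ 2 = ∑ b, ∑ b', β b * β b' *
        (qc b * qc b' * ((if b = b' then (Fintype.card F : ℤ) else 0) - 1)) := by
      simp_rw [sq (∑ b : F, _), Finset.sum_mul_sum]
      rw [Finset.sum_comm]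
      refine Finset.sum_congr rfl fun b _ => ?_
      rw [Finset.sum_comm]
      refine Finset.sum_congr rfl fun b' _ => ?_
      by_cases hb : b = 0
      · simp [hb, hβ0]
      by_cases hb' : b' = 0
      · simp [hb', hβ0]
      -- Near-orthogonality in a. The -1 part assembles into minus a perfect square, which is
      -- dropped in the bound.
      have : ∑ a : F, qc (1 + a * κ * b) * qc (1 + a * κ * b') =
          qc b * qc b' * ((if b = b' then (Fintype.card F : ℤ) else 0) - 1) := by
        have := sum_qc_mul hF (-b⁻¹) (-b'⁻¹)
        rw [← sum_comp_mul hκ] at this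
        simp only [neg_inj, inv_inj] at this
        rw [← this, Finset.mul_sum]
        refine Finset.sum_congr rfl fun a _ => ?_
        simp_rw [← qc_mul]
        congr 1; field_simp; ring
      rw [← this, Finset.mul_sum]
      exact Finset.sum_congr rfl fun a _ => by ring
    rw [e]
    have e2 : ∑ b, ∑ b', β b * β b' *
        (qc b * qc b' * ((if b = b' then (Fintype.card F : ℤ) else 0) - 1)) =
        Fintype.card F * ∑ b, (β b * qc b) ^ 2 - (∑ b, β b * qc b) ^ 2 := by
      rw [sq (∑ b, _), Finset.sum_mul_sum, Finset.mul_sum, ← Finset.sum_sub_distrib]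
      refine Finset.sum_congr rfl fun b _ => ?_
      simp_rw [mul_sub, mul_one, Finset.sum_sub_distrib, mul_ite, mul_zero, Finset.sum_ite_eq,
        Finset.mem_univ, if_true]
      congr 1
      · ring
      · exact Finset.sum_congr rfl fun b' _ => by ring
    have h4 : ∑ b, (β b * qc b) ^ 2 ≤ (Fintype.card F : ℤ) := by
      refine (Finset.sum_le_sum fun b _ => hsq (β b * qc b) ?_).trans (by simp)
      rw [abs_mul]
      exact mul_le_one₀ (hβ b) (abs_nonneg _) (abs_qc_le b)
    rw [e2]
    nlinarith [sq_nonneg (∑ b, β b * qc b)]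
  calc _ ≤ _ := h1
    _ ≤ (Fintype.card F : ℤ) * (Fintype.card F : ℤ) ^ 2 :=
        mul_le_mul h2 h3 (Finset.sum_nonneg fun _ _ => sq_nonneg _) (by positivity)
    _ = _ := by ring

theorem doubleSum_one_sq_le (hF : ringChar F ≠ 2) :
    doubleSum (1 : F) ^ 2 ≤ (Fintype.card F : ℤ) ^ 3 :=
  sq_bilinear_le hF one_ne_zero _ _ (fun _ => abs_qc_le _) (fun _ => abs_qc_le _)
    (by simp [qc_zero])

/-- Comparison of the two fourth moments. -/
theorem abs_sum_doubleSum_sub_legendreMoment_le (hF : ringChar F ≠ 2) :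
    |∑ m : F, qc (1 + m) * doubleSum (m ^ 2) - legendreMoment F| ≤
      |doubleSum (1 : F)| + 10 * Fintype.card F := by
  rw [sum_qc_doubleSum hF, legendreMoment_eq hF,
    sum_circle hF (fun δ => cubicSum δ⁻¹ ^ 2), legendreSum_two hF]
  have h1 := jacobsthalSum_one_sq_le hF
  have h0 := sq_nonneg (jacobsthalSum (1 : F))
  rw [abs_le]
  have ha := neg_abs_le (doubleSum (1 : F))
  have hb := le_abs_self (doubleSum (1 : F))
  rcases qc_cases (2 : F) with h | h | h <;> rw [h] <;> constructor <;> linarith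

end Correlation

/-! ### Reducing the Kloosterman and Gauss sum expressions to these moments. -/

section Reductions

variable {F : Type*} [Field F] [Fintype F] [DecidableEq F]

/-- The sum of `qc` over a pencil of cubics through `0` and `-1`. -/
def pencilSum (g h : F) : ℤ := ∑ k : F, qc (k * (1 + k)) * qc (g * k + h)

theorem sum_pencilSum_left (hF : ringChar F ≠ 2) (h : F) : ∑ g : F, pencilSum g h = 0 := by
  simp_rw [pencilSum]
  rw [Finset.sum_comm]
  refine Finset.sum_eq_zero fun k _ => ?_
  by_cases hk : k = 0
  · simp [hk, qc_zero]
  · simp_rw [← Finset.mul_sum, mul_comm _ k]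
    rw [sum_qc_affine hF hk, mul_zero]

theorem sum_pencilSum_right (hF : ringChar F ≠ 2) (g : F) : ∑ h : F, pencilSum g h = 0 := by
  simp_rw [pencilSum]
  rw [Finset.sum_comm]
  refine Finset.sum_eq_zero fun k _ => ?_
  have := sum_qc_affine hF (one_ne_zero (α := F)) (g * k)
  simp only [one_mul, add_comm _ (g * k)] at this
  rw [← Finset.mul_sum, this, mul_zero]

/-- By homogeneity, g = hj gives `pencilSum (h * j) h` = φ(h)L(j); the remaining sum over h is a
second copy of L(j). -/
theorem sum_qc_pencilSum :
    ∑ g : F, ∑ h : F, qc (g * (g + 1)) * qc (h * (h + 1)) * pencilSum g h = legendreMoment F := by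
  rw [Finset.sum_comm]
  have e : ∀ h : F, ∑ g : F, qc (g * (g + 1)) * qc (h * (h + 1)) * pencilSum g h =
      ∑ j : F, qc j * qc (h * (1 + h) * (1 + j * h)) * legendreSum j := by
    intro h
    by_cases hh : h = 0
    · simp [hh, qc_zero]
    · rw [← sum_comp_mul hh]
      refine Finset.sum_congr rfl fun j _ => ?_
      have : pencilSum (h * j) h = qc h * legendreSum j := by
        rw [pencilSum, legendreSum, Finset.mul_sum]
        refine Finset.sum_congr rfl fun k _ => ?_
        rw [← qc_mul, ← qc_mul]; congr 1; ring
      rw [this, ← mul_assoc]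
      congr 1
      simp_rw [← qc_mul]
      exact qc_eq_of_eq_mul_sq hh (by ring)
  simp_rw [e]
  rw [Finset.sum_comm, legendreMoment]
  refine Finset.sum_congr rfl fun j _ => ?_
  rw [← Finset.sum_mul, ← Finset.mul_sum, sq, ← mul_assoc]; rfl

/-- Passing from t, u to g, h brings weights 1 + φ(g(g+1)) and 1 + φ(h(h+1)); the constant parts
vanish since the pencil sums to zero in each variable. -/
theorem sum_ne_zero_pencilSum (hF : ringChar F ≠ 2) :
    ∑ t : F, (if t ≠ 0 then ∑ u : F, (if u ≠ 0 then
      pencilSum ((t + t⁻¹ - 2) / 4) ((u + u⁻¹ - 2) / 4) else 0) else 0) = legendreMoment F := by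
  rw [sum_reciprocal_sum hF (fun g => ∑ u : F, (if u ≠ 0 then
    pencilSum g ((u + u⁻¹ - 2) / 4) else 0))]
  have e : ∀ g : F, ∑ u : F, (if u ≠ 0 then pencilSum g ((u + u⁻¹ - 2) / 4) else 0) =
      ∑ h : F, qc (h * (h + 1)) * pencilSum g h := by
    intro g
    rw [sum_reciprocal_sum hF (pencilSum g), Finset.sum_congr rfl fun h _ => mul_one_add _ _,
      Finset.sum_add_distrib, sum_pencilSum_right hF, zero_add]
    exact Finset.sum_congr rfl fun h _ => mul_comm _ _
  simp_rw [e]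
  rw [Finset.sum_congr rfl fun h _ => mul_one_add _ _, Finset.sum_add_distrib, Finset.sum_comm]
  simp_rw [← Finset.mul_sum, sum_pencilSum_left hF]
  rw [← sum_qc_pencilSum]
  simp only [mul_zero, Finset.sum_const_zero, zero_add]
  refine Finset.sum_congr rfl fun g _ => ?_
  rw [mul_comm, Finset.mul_sum]
  exact Finset.sum_congr rfl fun h _ => by ring

theorem pencilSum_zero_left (hF : ringChar F ≠ 2) (h : F) : pencilSum 0 h = -qc h := by
  have := sum_qc_quadratic_form hF h (one_ne_zero (α := F))
  rw [← this, pencilSum]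
  refine Finset.sum_congr rfl fun k _ => ?_
  rw [← qc_mul]; congr 1; ring

theorem pencilSum_zero_right (hF : ringChar F ≠ 2) (g : F) : pencilSum g 0 = -qc g := by
  have : ∀ k : F, qc (k * (1 + k)) * qc (g * k + 0) =
      qc g * (qc (1 * k + 1) - if k = 0 then 1 else 0) := by
    intro k
    by_cases hk : k = 0
    · simp [hk, qc_zero, qc_one]
    · rw [if_neg hk, sub_zero, ← qc_mul, ← qc_mul]
      exact qc_eq_of_eq_mul_sq hk (by ring)
  rw [pencilSum]
  simp_rw [this]
  rw [← Finset.mul_sum, Finset.sum_sub_distrib, sum_qc_affine hF one_ne_zero]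
  simp

theorem qc_reciprocal_sum (hF : ringChar F ≠ 2) {t : F} (ht : t ≠ 0) (ht1 : t ≠ 1) :
    qc ((t + t⁻¹ - 2) / 4) = qc t := by
  have h2 := two_ne_zero_of_ringChar hF
  have h4 := four_ne_zero_of_ringChar hF
  refine qc_eq_of_eq_mul_sq (t := (t - 1) / (2 * t))
    (div_ne_zero (sub_ne_zero.2 ht1) (mul_ne_zero h2 ht)) ?_
  field_simp
  ring

/-- For t, u ≠ 1 the scaling y = k(1-t)/(1-u) gives the pencil. If exactly one of t, u is 1 the
summand is constant in y; these terms produce the -2q of `sum_qc_reciprocal`. -/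
theorem sum_qc_four_reciprocal (hF : ringChar F ≠ 2) {t u : F} (ht : t ≠ 0) (hu : u ≠ 0) :
    ∑ y : F, (if y ≠ 0 then qc ((1 + -t + y * (1 + -u)) *
      (1 + (-t)⁻¹ + y⁻¹ * (1 + (-u)⁻¹))) else 0) =
    qc (-1 : F) * (pencilSum ((t + t⁻¹ - 2) / 4) ((u + u⁻¹ - 2) / 4) +
      Fintype.card F * (if t = 1 then (if u = 1 then 0 else qc u) else 0) +
      Fintype.card F * (if u = 1 then (if t = 1 then 0 else qc t) else 0)) := by
  have h2 := two_ne_zero_of_ringChar hF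
  have h4 := four_ne_zero_of_ringChar hF
  have hsum : ∀ n : ℤ, ∑ y : F, (if y ≠ 0 then n else 0) = n * (Fintype.card F - 1) := by
    intro n
    have : ∀ y : F, (if y ≠ 0 then n else 0) = n - if y = 0 then n else 0 := by
      intro y; by_cases hy : y = 0 <;> simp [hy]
    simp_rw [this, Finset.sum_sub_distrib]
    simp; ring
  by_cases ht1 : t = 1
  · subst ht1
    have e0 : ((1 : F) + 1⁻¹ - 2) / 4 = 0 := by norm_num
    by_cases hu1 : u = 1
    · subst hu1
      rw [e0, pencilSum_zero_left hF]
      simp [qc_zero, inv_neg]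
    · rw [e0, pencilSum_zero_left hF, qc_reciprocal_sum hF hu hu1]
      have : ∀ y : F, (if y ≠ 0 then qc ((1 + -1 + y * (1 + -u)) *
          (1 + (-1)⁻¹ + y⁻¹ * (1 + (-u)⁻¹))) else 0) =
          if y ≠ 0 then qc (-1 : F) * qc u else 0 := by
        intro y
        by_cases hy : y = 0
        · simp [hy]
        · rw [if_pos hy, if_pos hy, ← qc_mul]
          refine qc_eq_of_eq_mul_sq (t := (u - 1) / u) (div_ne_zero (sub_ne_zero.2 hu1) hu) ?_
          rw [inv_neg, inv_neg]
          field_simp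
          ring
      simp_rw [this, hsum]
      simp [hu1]; ring
  · by_cases hu1 : u = 1
    · subst hu1
      have e0 : ((1 : F) + 1⁻¹ - 2) / 4 = 0 := by norm_num
      rw [e0, pencilSum_zero_right hF, qc_reciprocal_sum hF ht ht1]
      have : ∀ y : F, (if y ≠ 0 then qc ((1 + -t + y * (1 + -1)) *
          (1 + (-t)⁻¹ + y⁻¹ * (1 + (-1)⁻¹))) else 0) =
          if y ≠ 0 then qc (-1 : F) * qc t else 0 := by
        intro y
        by_cases hy : y = 0
        · simp [hy]
        · rw [if_pos hy, if_pos hy, ← qc_mul]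
          refine qc_eq_of_eq_mul_sq (t := (t - 1) / t) (div_ne_zero (sub_ne_zero.2 ht1) ht) ?_
          rw [inv_neg, inv_neg]
          field_simp
          ring
      simp_rw [this, hsum]
      simp [ht1]; ring
    · have n1 : (1 : F) - t ≠ 0 := sub_ne_zero.2 (Ne.symm ht1)
      have n2 : (1 : F) - u ≠ 0 := sub_ne_zero.2 (Ne.symm hu1)
      rw [if_neg ht1, if_neg hu1, mul_zero, add_zero, add_zero, pencilSum, Finset.mul_sum]
      conv_lhs => rw [← sum_comp_mul (div_ne_zero n1 n2)]
      refine Finset.sum_congr rfl fun k _ => ?_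
      by_cases hk : k = 0
      · simp [hk, qc_zero]
      · rw [if_pos (mul_ne_zero (div_ne_zero n1 n2) hk), ← qc_mul, ← qc_mul]
        refine qc_eq_of_eq_mul_sq (t := 2 / k) (div_ne_zero h2 hk) ?_
        rw [inv_neg, inv_neg]
        field_simp
        ring

/-- The four variable reciprocal sum attached to the fourth Kloosterman moment. -/
theorem sum_qc_reciprocal (hF : ringChar F ≠ 2) :
    ∑ v : F, (if v ≠ 0 then ∑ x : F, (if x ≠ 0 then ∑ y : F, (if y ≠ 0 then
      qc ((1 + v + y * (1 + x)) * (1 + v⁻¹ + y⁻¹ * (1 + x⁻¹))) else 0) else 0) else 0) =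
    qc (-1 : F) * (legendreMoment F - 2 * Fintype.card F) := by
  rw [← sum_comp_neg, ← sum_ne_zero_pencilSum hF]
  have e : ∀ t : F, (if -t ≠ 0 then ∑ x : F, (if x ≠ 0 then ∑ y : F, (if y ≠ 0 then
      qc ((1 + -t + y * (1 + x)) * (1 + (-t)⁻¹ + y⁻¹ * (1 + x⁻¹))) else 0) else 0) else 0) =
      qc (-1 : F) * ((if t ≠ 0 then ∑ u : F, (if u ≠ 0 then
      pencilSum ((t + t⁻¹ - 2) / 4) ((u + u⁻¹ - 2) / 4) else 0) else 0) -
      Fintype.card F * (if t = 1 then 1 else 0) +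
      Fintype.card F * (qc t - if t = 1 then 1 else 0)) := by
    intro t
    by_cases ht : t = 0
    · simp [ht, qc_zero]
    · rw [if_pos (neg_ne_zero.2 ht), if_pos ht]
      conv_lhs => rw [← sum_comp_neg]
      have e1 : ∀ u : F, (if -u ≠ 0 then ∑ y : F, (if y ≠ 0 then
          qc ((1 + -t + y * (1 + -u)) * (1 + (-t)⁻¹ + y⁻¹ * (1 + (-u)⁻¹))) else 0) else 0) =
          qc (-1 : F) * ((if u ≠ 0 then
            pencilSum ((t + t⁻¹ - 2) / 4) ((u + u⁻¹ - 2) / 4) else 0) +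
            Fintype.card F * (if t = 1 then qc u - (if u = 1 then 1 else 0) else 0) +
            Fintype.card F * (if u = 1 then (if t = 1 then 0 else qc t) else 0)) := by
        intro u
        by_cases hu : u = 0
        · simp [hu, qc_zero]
        · rw [if_pos (neg_ne_zero.2 hu), if_pos hu, sum_qc_four_reciprocal hF ht hu]
          congr 4
          by_cases h1 : u = 1 <;> simp [h1, qc_one]
      simp_rw [e1]
      rw [← Finset.mul_sum, Finset.sum_add_distrib, Finset.sum_add_distrib, ← Finset.mul_sum,
        ← Finset.mul_sum]
      congr 1
      have e2 : ∑ u : F, (if t = 1 then qc u - (if u = 1 then 1 else 0) else 0) =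
          -if t = 1 then (1 : ℤ) else 0 := by
        split_ifs
        · rw [Finset.sum_sub_distrib, sum_qc hF]; simp
        · simp
      rw [e2, Finset.sum_ite_eq' Finset.univ (1 : F), if_pos (Finset.mem_univ _)]
      by_cases h1 : t = 1 <;> simp [h1, qc_one]
      ring
  rw [Finset.sum_congr rfl fun t _ => e t, ← Finset.mul_sum, Finset.sum_add_distrib,
    Finset.sum_sub_distrib, ← Finset.mul_sum, ← Finset.mul_sum, Finset.sum_sub_distrib, sum_qc hF]
  simp
  left; ring

theorem sum_sum_product (hF : ringChar F ≠ 2) (f : F → F → ℤ) :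
    ∑ v : F, ∑ w : F, f (v + w) (v * w) = ∑ m : F, ∑ r : F, f m r * (1 + qc (m ^ 2 - 4 * r)) := by
  have e : ∀ v : F, ∑ w : F, f (v + w) (v * w) = ∑ m : F, f m (v * (m - v)) := by
    intro v
    rw [← sum_comp_affine one_ne_zero v (fun m => f m (v * (m - v)))]
    exact Finset.sum_congr rfl fun w _ => by congr 1 <;> ring
  simp_rw [e]
  rw [Finset.sum_comm]
  refine Finset.sum_congr rfl fun m _ => ?_
  rw [sum_fiber (fun v : F => v * (m - v)) (f m)]
  refine Finset.sum_congr rfl fun r _ => ?_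
  have := card_roots_quadratic hF (-m) r
  rw [neg_sq] at this
  rw [← this]
  congr 1
  refine Finset.sum_congr rfl fun v _ => if_congr ?_ rfl rfl
  exact ⟨fun h => by linear_combination -h, fun h => by linear_combination -h⟩

/-- The two variable sum obtained from the product of five Gauss sums. -/
def productSum (c : F) : ℤ :=
  ∑ v : F, ∑ w : F, qc (-(v * w) * (1 + (v + w)) * (1 + c * (v * w)))

/-- Use the symmetric functions m = v + w and r = vw. The 1 in the count 1 + φ(m² - 4r) contributes
a linear character sum in m, which is zero. -/
theorem productSum_eq (hF : ringChar F ≠ 2) (c : F) :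
    productSum c = ∑ m : F, ∑ r : F, qc (-r * (1 + m) * (1 + c * r)) * qc (m ^ 2 - 4 * r) := by
  rw [productSum, sum_sum_product hF (fun m r => qc (-r * (1 + m) * (1 + c * r)))]
  simp_rw [mul_add, mul_one, Finset.sum_add_distrib]
  have : ∑ m : F, ∑ r : F, qc (-r * (1 + m) * (1 + c * r)) = 0 := by
    rw [Finset.sum_comm]
    refine Finset.sum_eq_zero fun r _ => ?_
    have e : ∀ m : F, qc (-r * (1 + m) * (1 + c * r)) = qc (-r * (1 + c * r)) * qc (1 * m + 1) := by
      intro m; rw [← qc_mul]; congr 1; ring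
    simp_rw [e, ← Finset.mul_sum, sum_qc_affine hF one_ne_zero, mul_zero]
  simp only [mul_add, mul_one] at this
  rw [this, zero_add]

/-- For m ≠ 0 scale r by m², so that m² - 4r becomes a square times 1 - 4r. For m = 0 both sides
equal 1. -/
theorem sum_qc_productSum (hF : ringChar F ≠ 2) :
    ∑ c : F, qc (c * (c + 4)) * productSum c = ∑ m : F, qc (1 + m) * doubleSum (m ^ 2) := by
  have h2 := two_ne_zero_of_ringChar hF
  have h4 := four_ne_zero_of_ringChar hF
  simp_rw [productSum_eq hF, Finset.mul_sum]
  rw [Finset.sum_comm]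
  refine Finset.sum_congr rfl fun m _ => ?_
  by_cases hm : m = 0
  · subst hm
    have e1 : ∑ c : F, qc (c * (c + 4)) = -1 := by
      have := sum_qc_quadratic_form hF (1 : F) h4
      simpa [qc_one] using this
    have e2 : ∀ c : F, ∑ r : F, qc (c * (c + 4)) *
        (qc (-r * (1 + 0) * (1 + c * r)) * qc (0 ^ 2 - 4 * r)) = -qc (c * (c + 4)) := by
      intro c
      by_cases hc : c = 0
      · simp [hc, qc_zero]
      · have e3 : ∀ r : F, qc (-r * (1 + 0) * (1 + c * r)) * qc (0 ^ 2 - 4 * r) =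
            qc (c * r + 1) - if r = 0 then 1 else 0 := by
          intro r
          by_cases hr : r = 0
          · simp [hr, qc_zero, qc_one]
          · rw [if_neg hr, sub_zero, ← qc_mul]
            exact qc_eq_of_eq_mul_sq (mul_ne_zero h2 hr) (by ring)
        rw [← Finset.mul_sum]
        simp_rw [e3, Finset.sum_sub_distrib, sum_qc_affine hF hc]
        simp
    simp_rw [e2]
    rw [Finset.sum_neg_distrib, e1]
    simp [doubleSum_zero hF, qc_one]
  · rw [doubleSum, Finset.mul_sum]
    refine Finset.sum_congr rfl fun c _ => ?_
    conv_lhs => rw [← sum_comp_mul (pow_ne_zero 2 hm)]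
    rw [Finset.mul_sum]
    refine Finset.sum_congr rfl fun r _ => ?_
    simp_rw [← qc_mul]
    exact qc_eq_of_eq_mul_sq (pow_ne_zero 2 hm) (by ring)

/-- Linear change of variable hidden in the parameter `4 (1 - t) / t`. -/
theorem sum_qc_param (hF : ringChar F ≠ 2) (f : F → ℤ) :
    ∑ t : F, qc t * (qc (4 * (1 - t) / t) * f (4 * (1 - t) / t)) =
      ∑ c : F, qc (c * (c + 4)) * f c := by
  have h4 := four_ne_zero_of_ringChar hF
  have e := sum_comp_affine h4 (-4) (fun c : F => qc (c * (c + 4)) * f c)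
  rw [← e, ← sum_comp_inv]
  refine Finset.sum_congr rfl fun s _ => ?_
  by_cases hs : s = 0
  · simp [hs, qc_zero]
  · have : 4 * (1 - s⁻¹) / s⁻¹ = 4 * s + -4 := by field_simp; ring
    rw [this, ← mul_assoc, qc_inv, ← qc_mul]
    congr 1
    exact (qc_eq_of_eq_mul_sq (two_ne_zero_of_ringChar hF) (by ring)).symm

end Reductions

/-! ### Gauss sums and the fourth Kloosterman moment. -/

section Characters

variable {p : ℕ} [Fact p.Prime]

theorem ringChar_zmod_ne_two (hp : 2 < p) : ringChar (ZMod p) ≠ 2 := by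
  rw [ZMod.ringChar_zmod_n]; omega

theorem quadChar_apply (x : ZMod p) : quadChar p x = (qc x : ℂ) := rfl

theorem quadChar_ne_one (hp : 2 < p) : quadChar p ≠ 1 := by
  rw [quadChar, MulChar.ringHomComp_ne_one_iff (RingHom.injective_int _)]
  exact quadraticChar_ne_one (ringChar_zmod_ne_two hp)

theorem gaussSum_quadChar_sq (hp : 2 < p) {ψ : AddChar (ZMod p) ℂ} (hψ : ψ.IsPrimitive) :
    gaussSum (quadChar p) ψ ^ 2 = (qc (-1 : ZMod p) : ℂ) * p := by
  have h : (quadChar p).IsQuadratic := (quadraticChar_isQuadratic (F := ZMod p)).comp _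
  refine (gaussSum_sq (χ := quadChar p) (quadChar_ne_one hp) h hψ).trans ?_
  rw [ZMod.card]; rfl

theorem sum_qc_addChar (hp : 2 < p) (ψ : AddChar (ZMod p) ℂ) (s : ZMod p) :
    ∑ a : ZMod p, (qc a : ℂ) * ψ (a * s) = qc s * gaussSum (quadChar p) ψ := by
  by_cases hs : s = 0
  · subst hs
    simp only [mul_zero, AddChar.map_zero_eq_one, mul_one, qc_zero, Int.cast_zero, zero_mul]
    rw [← Int.cast_sum, sum_qc (ringChar_zmod_ne_two hp), Int.cast_zero]
  · rw [← sum_comp_mul (inv_ne_zero hs), gaussSum, Finset.mul_sum]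
    refine Finset.sum_congr rfl fun a _ => ?_
    rw [qc_mul, qc_inv, quadChar_apply, mul_right_comm, inv_mul_cancel₀ hs, one_mul]
    push_cast; ring

theorem sum_units {M : Type*} [AddCommMonoid M] (f : ZMod p → M) :
    ∑ u : (ZMod p)ˣ, f u = ∑ x : ZMod p, if x ≠ 0 then f x else 0 := by
  rw [← Finset.sum_filter]
  refine Finset.sum_bij (fun u _ => (u : ZMod p)) (by simp) (fun _ _ _ _ h => Units.ext h) ?_
    (fun _ _ => rfl)
  intro x hx
  have hx : x ≠ 0 := by simpa using hx
  exact ⟨Units.mk0 x hx, Finset.mem_univ _, rfl⟩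

theorem kloostermanSum_scale (a : ZMod p) (w : (ZMod p)ˣ) :
    kloostermanSum p a = ∑ v : (ZMod p)ˣ, ZMod.stdAddChar (N := p)
      ((w : ZMod p) * v + a * ((w : ZMod p)⁻¹ * (v : ZMod p)⁻¹)) := by
  rw [kloostermanSum, ← Equiv.sum_comp (Equiv.mulLeft w)]
  refine Finset.sum_congr rfl fun v _ => ?_
  simp only [Equiv.coe_mulLeft, mul_inv, Units.val_mul, Units.val_inv_eq_inv_val]

/-- The four variables are written w, wv, wy, wyx, so that w is a common scale on which the phase
depends only through w and a/w. -/
theorem kloostermanSum_pow_four (a : ZMod p) :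
    kloostermanSum p a ^ 4 = ∑ w : (ZMod p)ˣ, ∑ v : (ZMod p)ˣ, ∑ y : (ZMod p)ˣ, ∑ x : (ZMod p)ˣ,
      ZMod.stdAddChar (N := p) ((w : ZMod p) * (1 + v + y * (1 + x)) +
        a * ((w : ZMod p)⁻¹ * (1 + (v : ZMod p)⁻¹ + (y : ZMod p)⁻¹ * (1 + (x : ZMod p)⁻¹)))) := by
  have h1 : ∀ w v y x : (ZMod p)ˣ, ZMod.stdAddChar (N := p) ((w : ZMod p) * (1 + v + y * (1 + x)) +
        a * ((w : ZMod p)⁻¹ * (1 + (v : ZMod p)⁻¹ + (y : ZMod p)⁻¹ * (1 + (x : ZMod p)⁻¹)))) =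
      ZMod.stdAddChar (N := p) ((w : ZMod p) + a * (w : ZMod p)⁻¹) *
      (ZMod.stdAddChar (N := p) ((w : ZMod p) * v + a * ((w : ZMod p)⁻¹ * (v : ZMod p)⁻¹)) *
      (ZMod.stdAddChar (N := p) ((w : ZMod p) * y + a * ((w : ZMod p)⁻¹ * (y : ZMod p)⁻¹)) *
      ZMod.stdAddChar (N := p) (((w * y : (ZMod p)ˣ) : ZMod p) * x +
        a * (((w * y : (ZMod p)ˣ) : ZMod p)⁻¹ * (x : ZMod p)⁻¹)))) := by
    intro w v y x
    rw [← AddChar.map_add_eq_mul, ← AddChar.map_add_eq_mul, ← AddChar.map_add_eq_mul]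
    congr 1
    push_cast
    rw [mul_inv]
    ring
  simp_rw [h1, ← Finset.mul_sum, ← kloostermanSum_scale, ← Finset.sum_mul, ← kloostermanSum_scale]
  have : kloostermanSum p a =
      ∑ w : (ZMod p)ˣ, ZMod.stdAddChar (N := p) ((w : ZMod p) + a * (w : ZMod p)⁻¹) := by
    simp only [kloostermanSum, Units.val_inv_eq_inv_val]
  rw [← Finset.sum_mul, ← this]
  ring

/-- The sums over a and then w each give a quadratic Gauss sum; their product φ(-1)p absorbs the
sign in `sum_qc_reciprocal`. -/
theorem twistedMoment_four (hp : 2 < p) :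
    twistedMoment p 4 (quadChar p) = p * ((legendreMoment (ZMod p) : ℂ) - 2 * p) := by
  have hF := ringChar_zmod_ne_two hp
  set ψ : AddChar (ZMod p) ℂ := ZMod.stdAddChar with hψ
  have hψp : ψ.IsPrimitive := ZMod.isPrimitive_stdAddChar p
  have hg := gaussSum_quadChar_sq hp hψp
  set g := gaussSum (quadChar p) ψ with hgdef
  have h1 : twistedMoment p 4 (quadChar p) = ∑ v : (ZMod p)ˣ, ∑ y : (ZMod p)ˣ, ∑ x : (ZMod p)ˣ,
      g ^ 2 * (qc (((1 : ZMod p) + v + y * (1 + x)) *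
        (1 + (v : ZMod p)⁻¹ + (y : ZMod p)⁻¹ * (1 + (x : ZMod p)⁻¹))) : ℂ) := by
    rw [twistedMoment]
    simp_rw [kloostermanSum_pow_four, Finset.mul_sum]
    rw [Finset.sum_comm, Finset.sum_congr rfl fun w _ => Finset.sum_comm, Finset.sum_comm]
    refine Finset.sum_congr rfl fun v _ => ?_
    rw [Finset.sum_congr rfl fun w _ => Finset.sum_comm, Finset.sum_comm]
    refine Finset.sum_congr rfl fun y _ => ?_
    rw [Finset.sum_congr rfl fun w _ => Finset.sum_comm, Finset.sum_comm]
    refine Finset.sum_congr rfl fun x _ => ?_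
    set τ : ZMod p := 1 + v + y * (1 + x)
    set σ : ZMod p := 1 + (v : ZMod p)⁻¹ + (y : ZMod p)⁻¹ * (1 + (x : ZMod p)⁻¹)
    have h2 : ∀ w : (ZMod p)ˣ, ∑ a : ZMod p, quadChar p a * ψ ((w : ZMod p) * τ +
        a * ((w : ZMod p)⁻¹ * σ)) = g * qc σ * ((qc (w : ZMod p) : ℂ) * ψ (w * τ)) := by
      intro w
      have := sum_qc_addChar hp ψ ((w : ZMod p)⁻¹ * σ)
      rw [qc_mul, qc_inv] at this
      simp_rw [AddChar.map_add_eq_mul, quadChar_apply, mul_left_comm _ (ψ (_ * τ)), ← Finset.mul_sum,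
        this]
      push_cast; ring
    rw [Finset.sum_congr rfl fun w _ => h2 w, ← Finset.mul_sum]
    have h3 := sum_units (fun w : ZMod p => (qc w : ℂ) * ψ (w * τ))
    rw [h3]
    have h4 : ∀ w : ZMod p, (if w ≠ 0 then (qc w : ℂ) * ψ (w * τ) else 0) = qc w * ψ (w * τ) := by
      intro w
      by_cases hw : w = 0 <;> simp [hw, qc_zero]
    simp_rw [h4]
    rw [sum_qc_addChar hp, qc_mul]
    push_cast; ring
  have h5 := sum_qc_reciprocal hF
  have h6 : ∑ v : (ZMod p)ˣ, ∑ y : (ZMod p)ˣ, ∑ x : (ZMod p)ˣ,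
      (qc (((1 : ZMod p) + v + y * (1 + x)) *
        (1 + (v : ZMod p)⁻¹ + (y : ZMod p)⁻¹ * (1 + (x : ZMod p)⁻¹))) : ℤ) =
      qc (-1 : ZMod p) * (legendreMoment (ZMod p) - 2 * p) := by
    rw [ZMod.card] at h5
    rw [← h5, ← sum_units]
    refine Finset.sum_congr rfl fun v _ => ?_
    rw [← sum_units, Finset.sum_comm]
    refine Finset.sum_congr rfl fun x _ => ?_
    rw [← sum_units (fun y => qc ((1 + (v : ZMod p) + y * (1 + x)) *
        (1 + (v : ZMod p)⁻¹ + (y : ZMod p)⁻¹ * (1 + (x : ZMod p)⁻¹))))]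
  rw [h1]
  simp_rw [← Finset.mul_sum, ← Int.cast_sum]
  rw [h6, hg]
  have h7 : (qc (-1 : ZMod p) : ℂ) * qc (-1 : ZMod p) = 1 := by
    have := qc_mul_self (neg_ne_zero.2 (one_ne_zero (α := ZMod p)))
    exact_mod_cast this
  push_cast
  linear_combination (p : ℂ) * ((legendreMoment (ZMod p) : ℂ) - 2 * p) * h7

end Characters

/-! ### The product of five Gauss sums averaged over characters. -/

section MulCharSums

variable {p : ℕ} [Fact p.Prime]

theorem card_mulChar : Fintype.card (MulChar (ZMod p) ℂ) = p - 1 := by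
  have := DirichletCharacter.card_eq_totient_of_hasEnoughRootsOfUnity ℂ p
  rw [Nat.totient_prime Fact.out, Nat.card_eq_fintype_card] at this
  exact this

theorem sum_mulChar_apply (a : ZMod p) :
    ∑ χ : MulChar (ZMod p) ℂ, χ a = if a = 1 then (p : ℂ) - 1 else 0 := by
  have h := DirichletCharacter.sum_characters_eq ℂ (n := p) a
  have hp := (Fact.out : p.Prime)
  rw [Nat.totient_prime hp, Nat.cast_sub hp.one_le, Nat.cast_one] at h
  rw [← h]

theorem sum_range_pow_generator {ω : MulChar (ZMod p) ℂ} (hω : orderOf ω = p - 1)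
    (f : MulChar (ZMod p) ℂ → ℂ) : ∑ a ∈ Finset.range (p - 1), f (ω ^ a) = ∑ χ, f χ := by
  classical
  have hinj : Set.InjOn (fun a : ℕ => ω ^ a) (Finset.range (p - 1) : Set ℕ) := by
    intro a ha b hb hab
    have ha' : a < orderOf ω := by rw [hω]; simpa using ha
    have hb' : b < orderOf ω := by rw [hω]; simpa using hb
    exact pow_injOn_Iio_orderOf ha' hb' hab
  rw [← Finset.sum_image (g := fun a : ℕ => ω ^ a) (f := f) hinj]
  congr 1
  apply Finset.eq_univ_of_card
  rw [Finset.card_image_of_injOn hinj, Finset.card_range, card_mulChar]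

theorem quadChar_mul_apply (χ : MulChar (ZMod p) ℂ) (x : ZMod p) :
    (quadChar p * χ) x = (qc x : ℂ) * χ x := by
  rw [MulChar.mul_apply, quadChar_apply]

theorem sum_mul_ite_linear (hp : 2 < p) (a d : ZMod p) :
    ∑ v : ZMod p, (qc v : ℤ) * (if v * a = d then 1 else 0) = qc (d * a) := by
  by_cases ha : a = 0
  · subst ha
    by_cases hd : d = 0
    · simp [hd, qc_zero, sum_qc (ringChar_zmod_ne_two hp)]
    · simp [Ne.symm hd, qc_zero]
  · rw [Finset.sum_eq_single (d / a)]
    · rw [if_pos (by field_simp), mul_one]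
      exact (qc_eq_of_eq_mul_sq ha (by field_simp)).symm
    · intro v _ hv
      rw [if_neg, mul_zero]
      intro h; apply hv; rw [← h]; field_simp
    · simp

/-- Scaling out one variable in the product of five Gauss sums of total character trivial. -/
theorem gaussSum_five (hp : 2 < p) {ψ : AddChar (ZMod p) ℂ} (hψ : ψ.IsPrimitive)
    (χ : MulChar (ZMod p) ℂ) :
    gaussSum (quadChar p * χ) ψ * gaussSum χ⁻¹ ψ ^ 3 * gaussSum (quadChar p * χ ^ 2) ψ =
      ∑ x : ZMod p, ∑ y : ZMod p, ∑ z : ZMod p, ∑ u : ZMod p,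
        (qc u : ℂ) * χ (u * (x⁻¹ * y⁻¹ * z⁻¹)) *
          (if 1 + u + x + y + z = 0 then (p : ℂ) else 0) := by
  set P : ZMod p → ℂ := fun w => ∑ u, (quadChar p * χ) u * ψ (w * u) with hP
  set Q : ZMod p → ℂ := fun w => ∑ v, χ⁻¹ v * ψ (w * v) with hQ
  have scale : ∀ (θ : MulChar (ZMod p) ℂ) (w : ZMod p), w ≠ 0 →
      gaussSum θ ψ = θ w * ∑ u, θ u * ψ (w * u) := by
    intro θ w hw
    rw [gaussSum, ← sum_comp_mul hw, Finset.mul_sum]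
    exact Finset.sum_congr rfl fun u _ => by rw [map_mul]; ring
  have h1 : gaussSum (quadChar p * χ) ψ * gaussSum χ⁻¹ ψ ^ 3 * gaussSum (quadChar p * χ ^ 2) ψ =
      ∑ w : ZMod p, ψ w * (P w * Q w ^ 3) := by
    rw [gaussSum.eq_def (quadChar p * χ ^ 2), Finset.mul_sum]
    refine Finset.sum_congr rfl fun w _ => ?_
    by_cases hw : w = 0
    · subst hw
      rw [MulChar.map_zero, zero_mul, mul_zero]
      -- The term w = 0 must vanish for additive orthogonality to run over all w: P(0) = ∑ φ = 0 if
      -- χ is trivial, and Q(0) = 0 otherwise.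
      have : P 0 * Q 0 = 0 := by
        simp only [hP, hQ, zero_mul, AddChar.map_zero_eq_one, mul_one]
        by_cases h : χ = 1
        · subst h
          rw [mul_one, MulChar.sum_eq_zero_of_ne_one (quadChar_ne_one hp), zero_mul]
        · rw [MulChar.sum_eq_zero_of_ne_one (χ := χ⁻¹) (by simpa using h), mul_zero]
      rw [pow_succ', ← mul_assoc (P 0), this]; ring
    · rw [scale (quadChar p * χ) w hw, scale χ⁻¹ w hw]
      have e1 : χ w * χ⁻¹ w = 1 := by
        rw [← MulChar.mul_apply, mul_inv_cancel, MulChar.one_apply (isUnit_iff_ne_zero.2 hw)]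
      have e2 : (qc w : ℂ) * qc w = 1 := by exact_mod_cast qc_mul_self hw
      rw [quadChar_mul_apply, quadChar_mul_apply, MulChar.pow_apply' χ two_ne_zero]
      change _ = ψ w * (P w * Q w ^ 3)
      have : (qc w : ℂ) * χ w * P w * (χ⁻¹ w * Q w) ^ 3 * ((qc w : ℂ) * χ w ^ 2 * ψ w) =
        ((qc w : ℂ) * qc w) * (χ w * χ⁻¹ w) ^ 3 * (ψ w * (P w * Q w ^ 3)) := by ring
      rw [this, e1, e2]; ring
  rw [h1]
  have h2 : ∀ w : ZMod p, ψ w * (P w * Q w ^ 3) = ∑ x : ZMod p, ∑ y : ZMod p, ∑ z : ZMod p,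
      ∑ u : ZMod p, (qc u : ℂ) * χ (u * (x⁻¹ * y⁻¹ * z⁻¹)) * ψ (w * (1 + u + x + y + z)) := by
    intro w
    have e : ∀ x y z u : ZMod p, (qc u : ℂ) * χ (u * (x⁻¹ * y⁻¹ * z⁻¹)) *
        ψ (w * (1 + u + x + y + z)) = ψ w * ((χ⁻¹ x * ψ (w * x)) * ((χ⁻¹ y * ψ (w * y)) *
        ((χ⁻¹ z * ψ (w * z)) * ((quadChar p * χ) u * ψ (w * u))))) := by
      intro x y z u
      rw [quadChar_mul_apply, MulChar.inv_apply', MulChar.inv_apply', MulChar.inv_apply']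
      simp only [map_mul, mul_add, AddChar.map_add_eq_mul, mul_one]
      ring
    simp_rw [e, ← Finset.mul_sum, ← Finset.sum_mul]
    simp only [hP, hQ]
    ring
  simp_rw [h2]
  rw [Finset.sum_comm]
  refine Finset.sum_congr rfl fun x _ => ?_
  rw [Finset.sum_comm]
  refine Finset.sum_congr rfl fun y _ => ?_
  rw [Finset.sum_comm]
  refine Finset.sum_congr rfl fun z _ => ?_
  rw [Finset.sum_comm]
  refine Finset.sum_congr rfl fun u _ => ?_
  rw [← Finset.mul_sum, AddChar.sum_mulShift _ hψ, ZMod.card]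
  split_ifs <;> simp

/-- Orthogonality over χ forces u = cxyz. The additive constraint is then linear in z, and summing φ
over its solutions leaves a single character value. -/
theorem sum_mulChar_gaussSum_five (hp : 2 < p) {ψ : AddChar (ZMod p) ℂ} (hψ : ψ.IsPrimitive)
    (c : ZMod p) :
    ∑ χ : MulChar (ZMod p) ℂ, gaussSum (quadChar p * χ) ψ * gaussSum χ⁻¹ ψ ^ 3 *
      gaussSum (quadChar p * χ ^ 2) ψ * χ⁻¹ c =
    (p : ℂ) * (p - 1) * (qc c * productSum c : ℤ) := by
  have e1 : ∀ χ : MulChar (ZMod p) ℂ, gaussSum (quadChar p * χ) ψ * gaussSum χ⁻¹ ψ ^ 3 *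
      gaussSum (quadChar p * χ ^ 2) ψ * χ⁻¹ c =
      ∑ x : ZMod p, ∑ y : ZMod p, ∑ z : ZMod p, ∑ u : ZMod p,
        ((qc u : ℂ) * (if 1 + u + x + y + z = 0 then (p : ℂ) else 0)) *
          χ (u * (x⁻¹ * y⁻¹ * z⁻¹) * c⁻¹) := by
    intro χ
    rw [gaussSum_five hp hψ, MulChar.inv_apply']
    simp_rw [Finset.sum_mul, map_mul]
    refine Finset.sum_congr rfl fun x _ => Finset.sum_congr rfl fun y _ =>
      Finset.sum_congr rfl fun z _ => Finset.sum_congr rfl fun u _ => by ring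
  simp_rw [e1]
  rw [Finset.sum_comm, productSum, Finset.mul_sum, Int.cast_sum, Finset.mul_sum]
  refine Finset.sum_congr rfl fun x _ => ?_
  rw [Finset.sum_comm, Finset.mul_sum, Int.cast_sum, Finset.mul_sum]
  refine Finset.sum_congr rfl fun y _ => ?_
  have e2 : qc c * qc (-(x * y) * (1 + (x + y)) * (1 + c * (x * y))) =
      ∑ z : ZMod p, qc (c * (x * y) * z) *
        (if z * (1 + c * (x * y)) = -(1 + (x + y)) then 1 else 0) := by
    simp_rw [qc_mul _ (_ : ZMod p)]
    simp_rw [mul_assoc _ (qc _) (ite _ _ _), ← Finset.mul_sum, sum_mul_ite_linear hp]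
    simp_rw [← qc_mul]
    congr 1; ring
  rw [e2, Finset.sum_comm, Int.cast_sum, Finset.mul_sum]
  refine Finset.sum_congr rfl fun z _ => ?_
  rw [Finset.sum_comm]
  simp_rw [← Finset.mul_sum, sum_mulChar_apply]
  by_cases hc : c * (x * y) * z = 0
  · rw [hc, qc_zero]
    have : ∀ u : ZMod p, u * (x⁻¹ * y⁻¹ * z⁻¹) * c⁻¹ ≠ 1 := by
      intro u
      have : u * (x⁻¹ * y⁻¹ * z⁻¹) * c⁻¹ = u * (c * (x * y) * z)⁻¹ := by
        simp only [mul_inv]; ring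
      rw [this, hc]; simp
    simp [this]
  · rw [Finset.sum_eq_single (c * (x * y) * z)]
    · have h1 : c * (x * y) * z * (x⁻¹ * y⁻¹ * z⁻¹) * c⁻¹ = 1 := by
        have : c * (x * y) * z * (x⁻¹ * y⁻¹ * z⁻¹) * c⁻¹ =
            c * (x * y) * z * (c * (x * y) * z)⁻¹ := by simp only [mul_inv]; ring
        rw [this, mul_inv_cancel₀ hc]
      rw [if_pos h1]
      have h2 : (1 + c * (x * y) * z + x + y + z = 0) ↔
          (z * (1 + c * (x * y)) = -(1 + (x + y))) :=
        ⟨fun h => by linear_combination h, fun h => by linear_combination h⟩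
      simp_rw [h2]
      split_ifs
      · push_cast; ring
      · simp
    · intro u _ hu
      have h1 : u * (x⁻¹ * y⁻¹ * z⁻¹) * c⁻¹ = u * (c * (x * y) * z)⁻¹ := by
        simp only [mul_inv]; ring
      have h2 : ¬u * (x⁻¹ * y⁻¹ * z⁻¹) * c⁻¹ = 1 := by
        rw [h1]; exact fun h => hu ((mul_inv_eq_one₀ hc).1 h)
      rw [if_neg h2, mul_zero]
    · simp

theorem gaussCharSum_eq (hp : 2 < p) {ω : MulChar (ZMod p) ℂ} (hω : orderOf ω = p - 1) {ζ : ℂ}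
    (hζ : IsPrimitiveRoot ζ p) :
    gaussCharSum p ζ ω = (p : ℂ) * (p - 1) *
      ((∑ m : ZMod p, qc (1 + m) * doubleSum (m ^ 2) : ℤ) : ℂ) := by
  have hF := ringChar_zmod_ne_two hp
  have hψ := AddChar.zmodChar_primitive_of_primitive_root p hζ
  set ψ := AddChar.zmodChar p ((IsPrimitiveRoot.iff_def ζ p).mp hζ).left with hψdef
  have hg : ∀ χ : MulChar (ZMod p) ℂ, gSum p ζ χ = gaussSum χ ψ := fun χ =>
    Finset.sum_congr rfl fun x _ => by rw [hψdef, AddChar.zmodChar_apply]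
  rw [gaussCharSum]
  have e : ∀ t : ZMod p, ∑ a ∈ Finset.range (p - 1),
      gSum p ζ (quadChar p * ω ^ a) * gSum p ζ (ω⁻¹ ^ a) ^ 3 *
        gSum p ζ (quadChar p * ω ^ (2 * a)) * (ω⁻¹ ^ a) (4 * (1 - t) / t) =
      (p : ℂ) * (p - 1) * (qc (4 * (1 - t) / t) * productSum (4 * (1 - t) / t) : ℤ) := by
    intro t
    rw [← sum_mulChar_gaussSum_five hp hψ, ← sum_range_pow_generator hω]
    refine Finset.sum_congr rfl fun a _ => ?_
    rw [hg, hg, hg, inv_pow, mul_comm 2 a, pow_mul]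
  simp_rw [e, quadChar_apply, mul_left_comm _ ((p : ℂ) * (p - 1))]
  rw [← Finset.mul_sum]
  congr 1
  rw [← sum_qc_productSum hF, ← sum_qc_param hF]
  push_cast
  rfl

end MulCharSums

/-! ### Hypergeometric values as character sums, and their bounds. -/

section Hypergeometric

variable {p : ℕ} [Fact p.Prime]

theorem cast_prime_ne_zero : (p : ℂ) ≠ 0 := Nat.cast_ne_zero.2 (Fact.out : p.Prime).ne_zero

theorem cast_prime_sub_one_ne_zero : (p : ℂ) - 1 ≠ 0 := by
  rw [sub_ne_zero]; exact_mod_cast (Fact.out : p.Prime).ne_one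

/-- The involution y ↦ y/(y-1) off y = 1 merges χ(-1), χ(y) and χ⁻¹(1-y) into one value of χ, ready
for orthogonality. -/
theorem charBinom_quadChar_mul (χ : MulChar (ZMod p) ℂ) :
    charBinom p (quadChar p * χ) χ =
      1 / (p : ℂ) * ∑ w : ZMod p, (qc (w * (w - 1)) : ℂ) * χ w := by
  rw [charBinom, jacobiSum, Finset.mul_sum, Finset.mul_sum]
  have h1 : ∀ y : ZMod p, χ (-1) / (p : ℂ) * ((quadChar p * χ) y * χ⁻¹ (1 - y)) =
      1 / (p : ℂ) * (qc y * χ (y * (y - 1)⁻¹)) := by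
    intro y
    have : y * (y - 1)⁻¹ = -1 * y * (1 - y)⁻¹ := by
      rw [← neg_sub 1 y, inv_neg]; ring
    rw [quadChar_mul_apply, MulChar.inv_apply', this, map_mul, map_mul]
    ring
  rw [Finset.sum_congr rfl fun y _ => h1 y, ← Finset.mul_sum, ← Finset.mul_sum]
  congr 1
  rw [← Finset.sum_subset (Finset.subset_univ ({1}ᶜ : Finset (ZMod p))),
    ← Finset.sum_subset (Finset.subset_univ ({1}ᶜ : Finset (ZMod p)))
      (f := fun w => (qc (w * (w - 1)) : ℂ) * χ w)]
  · refine Finset.sum_nbij' (fun y => y * (y - 1)⁻¹) (fun y => y * (y - 1)⁻¹) ?_ ?_ ?_ ?_ ?_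
    all_goals
      intro y hy
      have hy1 : y ≠ 1 := by simpa using hy
      have hy' : y - 1 ≠ 0 := sub_ne_zero.2 hy1
      have h3 : y * (y - 1)⁻¹ - 1 = (y - 1)⁻¹ := by field_simp; ring
    · have : y * (y - 1)⁻¹ ≠ 1 := by
        intro h; rw [h, sub_self] at h3; exact inv_ne_zero hy' h3.symm
      simpa using this
    · have : y * (y - 1)⁻¹ ≠ 1 := by
        intro h; rw [h, sub_self] at h3; exact inv_ne_zero hy' h3.symm
      simpa using this
    · simp only [h3]; field_simp
    · simp only [h3]; field_simp
    · simp only [h3]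
      congr 2
      exact (qc_eq_of_eq_mul_sq (inv_ne_zero hy') (by ring)).symm
  · intro y _ hy
    have : y = 1 := by simpa using hy
    simp [this, qc_zero]
  · intro y _ hy
    have : y = 1 := by simpa using hy
    simp [this, MulChar.map_zero]

theorem hyp2F1_eq {x : ZMod p} (hx : x ≠ 0) :
    hyp2F1 p x = 1 / (p : ℂ) * (∑ w : ZMod p, qc (w * (w - 1) * (1 - w * x)) : ℤ) := by
  have hp0 := cast_prime_ne_zero (p := p)
  have hp1 := cast_prime_sub_one_ne_zero (p := p)
  rw [hyp2F1, greene2F1, finsum_eq_sum_of_fintype]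
  have e : ∀ χ : MulChar (ZMod p) ℂ, charBinom p (quadChar p * χ) χ *
      charBinom p (quadChar p * χ) (1 * χ) * χ x =
      1 / (p : ℂ) ^ 2 * ∑ w : ZMod p, ∑ v : ZMod p,
        (qc (w * (w - 1)) * qc (v * (v - 1)) : ℂ) * χ (w * v * x) := by
    intro χ
    rw [one_mul, charBinom_quadChar_mul]
    have : ∀ w v : ZMod p, (qc (w * (w - 1)) * qc (v * (v - 1)) : ℂ) * χ (w * v * x) =
        ((qc (w * (w - 1)) : ℂ) * χ w) * (((qc (v * (v - 1)) : ℂ) * χ v) * χ x) := by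
      intro w v; rw [map_mul, map_mul]; ring
    simp_rw [this, ← Finset.mul_sum, ← Finset.sum_mul]
    field_simp
  simp_rw [e]
  rw [← Finset.mul_sum, Finset.sum_comm]
  have e2 : ∀ w : ZMod p, ∑ χ : MulChar (ZMod p) ℂ, ∑ v : ZMod p,
      (qc (w * (w - 1)) * qc (v * (v - 1)) : ℂ) * χ (w * v * x) =
      (p - 1) * qc (w * (w - 1) * (1 - w * x)) := by
    intro w
    rw [Finset.sum_comm]
    simp_rw [← Finset.mul_sum, sum_mulChar_apply]
    by_cases hw : w = 0
    · simp [hw, qc_zero]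
    · rw [Finset.sum_eq_single (w * x)⁻¹]
      · have hwx := mul_ne_zero hw hx
        have h1 : w * (w * x)⁻¹ * x = 1 := by field_simp
        rw [if_pos h1, mul_comm]
        congr 1
        rw [← Int.cast_mul, ← qc_mul]
        congr 1
        exact qc_eq_of_eq_mul_sq (inv_ne_zero hwx) (by field_simp)
      · intro v _ hv
        rw [if_neg, mul_zero]
        intro h
        apply hv
        exact eq_inv_of_mul_eq_one_left (by linear_combination h)
      · simp
  simp_rw [e2]
  rw [← Finset.mul_sum, ← mul_assoc, ← mul_assoc]
  push_cast
  congr 1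
  field_simp

/-- Orthogonality solves u = 1/(wv). The kernel is written 1 + w(-1)v to match `sq_bilinear_le` with
κ = -1. -/
theorem hyp3F2_one_eq :
    hyp3F2 p 1 = 1 / (p : ℂ) ^ 2 * (∑ w : ZMod p, ∑ v : ZMod p,
      qc (w * (w - 1)) * (qc (v * (v - 1)) * qc (1 + w * (-1) * v)) : ℤ) := by
  have hp0 := cast_prime_ne_zero (p := p)
  have hp1 := cast_prime_sub_one_ne_zero (p := p)
  rw [hyp3F2, greene3F2, finsum_eq_sum_of_fintype]
  have e : ∀ χ : MulChar (ZMod p) ℂ, charBinom p (quadChar p * χ) χ *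
      charBinom p (quadChar p * χ) (1 * χ) * charBinom p (quadChar p * χ) (1 * χ) * χ 1 =
      1 / (p : ℂ) ^ 3 * ∑ w : ZMod p, ∑ v : ZMod p, ∑ u : ZMod p,
        (qc (w * (w - 1)) * qc (v * (v - 1)) * qc (u * (u - 1)) : ℂ) * χ (w * v * u) := by
    intro χ
    rw [one_mul, charBinom_quadChar_mul, map_one]
    have : ∀ w v u : ZMod p,
        (qc (w * (w - 1)) * qc (v * (v - 1)) * qc (u * (u - 1)) : ℂ) * χ (w * v * u) =
        ((qc (w * (w - 1)) : ℂ) * χ w) * (((qc (v * (v - 1)) : ℂ) * χ v) *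
          ((qc (u * (u - 1)) : ℂ) * χ u)) := by
      intro w v u; rw [map_mul, map_mul]; ring
    simp_rw [this, ← Finset.mul_sum, ← Finset.sum_mul]
    field_simp
  simp_rw [e]
  rw [← Finset.mul_sum, Finset.sum_comm]
  have e2 : ∀ w : ZMod p, ∑ χ : MulChar (ZMod p) ℂ, ∑ v : ZMod p, ∑ u : ZMod p,
      (qc (w * (w - 1)) * qc (v * (v - 1)) * qc (u * (u - 1)) : ℂ) * χ (w * v * u) =
      (p - 1) * ∑ v : ZMod p,
        ((qc (w * (w - 1)) * (qc (v * (v - 1)) * qc (1 + w * (-1) * v)) : ℤ) : ℂ) := by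
    intro w
    rw [Finset.sum_comm, Finset.mul_sum]
    refine Finset.sum_congr rfl fun v _ => ?_
    rw [Finset.sum_comm]
    simp_rw [← Finset.mul_sum, sum_mulChar_apply]
    by_cases hw : w * v = 0
    · rcases mul_eq_zero.1 hw with h | h <;> simp [h, qc_zero]
    · rw [Finset.sum_eq_single (w * v)⁻¹]
      · rw [if_pos (mul_inv_cancel₀ hw), mul_comm]
        congr 1
        rw [← Int.cast_mul, ← Int.cast_mul, ← mul_assoc]
        congr 2
        have h1 : 1 + w * (-1) * v = 1 - w * v := by ring
        rw [h1]
        exact qc_eq_of_eq_mul_sq (inv_ne_zero hw) (by generalize w * v = a at *; field_simp)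
      · intro u _ hu
        rw [if_neg, mul_zero]
        intro h
        apply hu
        exact eq_inv_of_mul_eq_one_left (by linear_combination h)
      · simp
  simp_rw [e2]
  rw [← Finset.mul_sum, ← mul_assoc, ← mul_assoc]
  push_cast
  congr 1
  field_simp

theorem hyp2F1_neg_one : hyp2F1 p (-1) = 1 / (p : ℂ) * (jacobsthalSum (1 : ZMod p) : ℤ) := by
  rw [hyp2F1_eq (neg_ne_zero.2 one_ne_zero), jacobsthalSum]
  congr 2
  exact Finset.sum_congr rfl fun w _ => by congr 1; ring

theorem hyp2F1_half (hp : 2 < p) :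
    hyp2F1 p (1 / 2) =
      1 / (p : ℂ) * (qc (-2 : ZMod p) * jacobsthalSum (1 : ZMod p) : ℤ) := by
  have h2 : (2 : ZMod p) ≠ 0 := two_ne_zero_of_ringChar (ringChar_zmod_ne_two hp)
  rw [hyp2F1_eq (one_div_ne_zero h2), jacobsthalSum]
  congr 2
  rw [← sum_comp_affine one_ne_zero 1, Finset.mul_sum]
  refine Finset.sum_congr rfl fun w _ => ?_
  rw [← qc_mul]
  refine (qc_eq_of_eq_mul_sq h2 ?_).symm
  field_simp
  ring

theorem norm_qc_le (x : ZMod p) : ‖quadChar p x‖ ≤ 1 := by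
  rw [quadChar_apply, Complex.norm_intCast]
  exact_mod_cast abs_qc_le x

theorem norm_sq_mul_hyp2F1_sq (x : ZMod p) {n : ℤ} (h : hyp2F1 p x = 1 / (p : ℂ) * n)
    (hn : n ^ 2 ≤ 8 * p) (y : ZMod p) :
    ‖(p : ℂ) ^ 2 * quadChar p y * hyp2F1 p x ^ 2‖ ≤ 8 * p := by
  have hp0 := cast_prime_ne_zero (p := p)
  have e : (p : ℂ) ^ 2 * quadChar p y * hyp2F1 p x ^ 2 = quadChar p y * ((n ^ 2 : ℤ) : ℂ) := by
    rw [h]; push_cast; field_simp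
  rw [e, norm_mul, Complex.norm_intCast]
  have h1 : |((n ^ 2 : ℤ) : ℝ)| ≤ 8 * p := by
    rw [abs_of_nonneg (by positivity)]; exact_mod_cast hn
  calc _ ≤ 1 * (8 * (p : ℝ)) := mul_le_mul (norm_qc_le y) h1 (abs_nonneg _) zero_le_one
    _ = _ := one_mul _

theorem abs_le_of_sq_le_cube {n : ℤ} (h : n ^ 2 ≤ (p : ℤ) ^ 3) : |(n : ℝ)| ≤ p * √p := by
  apply abs_le_of_sq_le_sq _ (by positivity)
  rw [mul_pow, Real.sq_sqrt (by positivity)]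
  have : (n : ℝ) ^ 2 ≤ (p : ℝ) ^ 3 := by exact_mod_cast h
  linarith [this, (by ring : (p : ℝ) ^ 3 = p ^ 2 * p)]

theorem norm_sq_mul_hyp3F2_one (hp : 2 < p) (y : ZMod p) :
    ‖(p : ℂ) ^ 2 * quadChar p y * hyp3F2 p 1‖ ≤ p * √p := by
  have hp0 := cast_prime_ne_zero (p := p)
  rw [hyp3F2_one_eq]
  have hn := sq_bilinear_le (ringChar_zmod_ne_two hp) (neg_ne_zero.2 (one_ne_zero (α := ZMod p)))
    (fun w => qc (w * (w - 1))) (fun w => qc (w * (w - 1))) (fun _ => abs_qc_le _)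
    (fun _ => abs_qc_le _) (by simp [qc_zero])
  rw [ZMod.card] at hn
  have h1 := abs_le_of_sq_le_cube hn
  set n : ℤ := ∑ w : ZMod p, ∑ v : ZMod p,
      qc (w * (w - 1)) * (qc (v * (v - 1)) * qc (1 + w * (-1) * v))
  have e : (p : ℂ) ^ 2 * quadChar p y * (1 / (p : ℂ) ^ 2 * n) = quadChar p y * n := by
    field_simp
  rw [e, norm_mul, Complex.norm_intCast]
  calc _ ≤ 1 * (p * √p) := mul_le_mul (norm_qc_le y) h1 (abs_nonneg _) zero_le_one
    _ = _ := one_mul _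

theorem norm_twistedMoment_sub_gaussCharSum (hp : 2 < p) {ω : MulChar (ZMod p) ℂ}
    (hω : orderOf ω = p - 1) {ζ : ℂ} (hζ : IsPrimitiveRoot ζ p) :
    ‖twistedMoment p 4 (quadChar p) / (p : ℂ) -
      1 / ((p : ℂ) * ((p : ℂ) - 1)) * gaussCharSum p ζ ω‖ ≤ p * √p + 12 * p := by
  have hp0 := cast_prime_ne_zero (p := p)
  have hp1 := cast_prime_sub_one_ne_zero (p := p)
  have hF := ringChar_zmod_ne_two hp
  have h := abs_sum_doubleSum_sub_legendreMoment_le hF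
  have hd := doubleSum_one_sq_le hF
  rw [ZMod.card] at h hd
  have hd' := abs_le_of_sq_le_cube hd
  rw [twistedMoment_four hp, gaussCharSum_eq hp hω hζ]
  set G : ℤ := ∑ m : ZMod p, qc (1 + m) * doubleSum (m ^ 2)
  set T : ℤ := legendreMoment (ZMod p)
  have e : (p : ℂ) * ((T : ℂ) - 2 * p) / p -
      1 / ((p : ℂ) * ((p : ℂ) - 1)) * ((p : ℂ) * (p - 1) * (G : ℂ)) =
      ((-(G - T) - 2 * p : ℤ) : ℂ) := by
    push_cast; field_simp; ring
  rw [e, Complex.norm_intCast]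
  have h' : |((G - T : ℤ) : ℝ)| ≤ |(doubleSum (1 : ZMod p) : ℝ)| + 10 * p := by exact_mod_cast h
  have hb := abs_le.1 h'
  push_cast at hb ⊢
  have hpos : (0 : ℝ) ≤ p := by positivity
  rw [abs_le]
  constructor <;> linarith [hb.1, hb.2]

end Hypergeometric

/-! ### Assembling the error bounds. -/

theorem mainTheorem10 :
    ∀ ε : ℝ, 0 < ε → ∃ N : ℕ, ∀ (p : ℕ) [Fact p.Prime], 3 < p → N ≤ p →
      ∀ ω : MulChar (ZMod p) ℂ, orderOf ω = p - 1 →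
      ∀ ζ : ℂ, IsPrimitiveRoot ζ p →
        ‖twistedMoment p 4 (quadChar p) / (p : ℂ) -
          ((p : ℂ) ^ 2 * quadChar p 2 * hyp2F1 p (1 / 2) ^ 2
            - (p : ℂ) ^ 2 * quadChar p (-1) * hyp2F1 p (-1) ^ 2
            - (p : ℂ) ^ 2 * quadChar p (-2) * hyp3F2 p 1
            + 1 / ((p : ℂ) * ((p : ℂ) - 1)) * gaussCharSum p ζ ω)‖ ≤ ε * (p : ℝ) ^ 2 := by
  intro ε hε
  -- The total error is at most 2p√p + 28p ≤ 30p√p, with 28 = 12 + 8 + 8; this is at most εp² once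
  -- √p ≥ 30/ε.
  obtain ⟨N, hN⟩ := exists_nat_ge ((30 / ε) ^ 2)
  refine ⟨N, fun p _ hp hNp ω hω ζ hζ => ?_⟩
  have hp2 : 2 < p := by omega
  have hJ := jacobsthalSum_one_sq_le (ringChar_zmod_ne_two hp2)
  rw [ZMod.card] at hJ
  have hJ' : (qc (-2 : ZMod p) * jacobsthalSum (1 : ZMod p)) ^ 2 ≤ 8 * (p : ℤ) := by
    have h2 : (-2 : ZMod p) ≠ 0 :=
      neg_ne_zero.2 (two_ne_zero_of_ringChar (ringChar_zmod_ne_two hp2))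
    rw [mul_pow, sq (qc _), qc_mul_self h2, one_mul]
    exact hJ
  have b1 := norm_sq_mul_hyp2F1_sq _ (hyp2F1_half hp2) hJ' 2
  have b2 := norm_sq_mul_hyp2F1_sq _ (hyp2F1_neg_one (p := p)) hJ (-1)
  have b3 := norm_sq_mul_hyp3F2_one hp2 (-2)
  have b4 := norm_twistedMoment_sub_gaussCharSum hp2 hω hζ
  set X := twistedMoment p 4 (quadChar p) / (p : ℂ)
  set Y := 1 / ((p : ℂ) * ((p : ℂ) - 1)) * gaussCharSum p ζ ω
  set A := (p : ℂ) ^ 2 * quadChar p 2 * hyp2F1 p (1 / 2) ^ 2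
  set B := (p : ℂ) ^ 2 * quadChar p (-1) * hyp2F1 p (-1) ^ 2
  set C := (p : ℂ) ^ 2 * quadChar p (-2) * hyp3F2 p 1
  have hsum : ‖X - (A - B - C + Y)‖ ≤ ‖X - Y‖ + ‖A‖ + ‖B‖ + ‖C‖ := by
    have : X - (A - B - C + Y) = X - Y - A + B + C := by ring
    rw [this]
    refine (norm_add_le _ _).trans ?_
    gcongr
    refine (norm_add_le _ _).trans ?_
    gcongr
    exact norm_sub_le _ _
  have hp1 : (1 : ℝ) ≤ p := by exact_mod_cast (Fact.out : p.Prime).one_le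
  have hs1 : 1 ≤ √(p : ℝ) := Real.one_le_sqrt.2 hp1
  have hs2 : √(p : ℝ) * √(p : ℝ) = p := Real.mul_self_sqrt (by positivity)
  have hs3 : 30 / ε ≤ √(p : ℝ) := by
    apply Real.le_sqrt_of_sq_le
    exact hN.trans (by exact_mod_cast hNp)
  have hs4 : 30 ≤ ε * √(p : ℝ) := by
    rw [div_le_iff₀ hε] at hs3; linarith
  calc _ ≤ _ := hsum
    _ ≤ 2 * (p * √p) + 28 * (p : ℝ) := by linarith
    _ ≤ 30 * (p * √p) := by nlinarith
    _ ≤ (ε * √p) * (p * √p) := by gcongr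
    _ = ε * (p * (√p * √p)) := by ring
    _ = ε * (p : ℝ) ^ 2 := by rw [hs2]; ring
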